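/- Let $n\ge 1$, $[n]=\{1,\dots,n\}$. Fix a partition $[n]=D\sqcup U$ with $1,n\in D$ (the down set and the up set; such partitions correspond to the Coxeter elements $c$ of the symmetric group $\Sigma_n$), and put $\overline D=D\cup\{0,n+1\}$. **Polygon.** $Q_c$ is a convex $(n+2)$-gon whose vertices, in counter-clockwise order, are labelled by the elements of $\overline D$ in increasing order followed by the elements of $U$ in decreasing order. A proper diagonal is a pair of distinct non-adjacent vertices. For a proper diagonal $\delta=\{x,y\}$, $x<y$, oriented from $x$ to $y$, let $R_\delta\subseteq[n]$ be the set of labels strictly to the right of $\delta$, where $0$ is replaced by $x$ if $x\in U$ and deleted otherwise, and $n+1$ is replaced by $y$ if $y\in U$ and deleted otherwise. If $\delta=\{x,y\}$ is an edge of $Q_c$ or degenerate ($x=y$), put $R_\delta=[n]$ if $\delta=\{0,n+1\}$ and $U=\varnothing$; otherwise put $R_\delta=\varnothing$ if $x,y\in\overline D$, and $R_\delta=[n]$ if not. **Associahedra.** For real numbers $z_I$ let $$P_n(\{z_I\})=\Bigl\{x\in\mathbb R^n:\ \sum_{i\in[n]}x_i=z_{[n]},\ \sum_{i\in I}x_i\ge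 z_I\text{ for }\varnothing\subsetneq I\subsetneq[n]\Bigr\}.$$ Let $(w_I)_{I\subseteq[n]}$, $w_\varnothing=0$, be real numbers in the (closed) deformation cone of the classical permutahedron, i.e. no facet hyperplane is moved past a vertex: for every complete flag $\varnothing=J_0\subsetneq J_1\subsetneq\dots\subsetneq J_n=[n]$ the point $x$ determined by $\sum_{i\in J_k}x_i=w_{J_k}$ $(0\le k\le n)$ lies in $P_n(\{w_I\})$. Let $\mathsf{As}^c_{n-1}$ be the polytope obtained from $P_n(\{w_I\})$ by dropping all inequalities except those with $I=R_\delta$ for a proper diagonal $\delta$ of $Q_c$, keeping the equation $\sum_{i\in[n]} x_i=w_{[n]}$. **Up and down intervals.** For $I\subseteq[n]$ non-empty, the down intervals of $I$ are the pairs $(a,b)$ with $a<b$ in $\overline D$ and $a,b\notin I$ such that, writing $(a,b)_D=\{d\in D:a<d<b\}$, either $\varnothing\ne(a,b)_D\subseteq I$, or $(a,b)_D=\varnothing$ and some $u\in I\cap U$ satisfies $a<u<b$. Let $v$ be their number (the number of nested components of $I$). **Theorem.** For every $I\subseteq[n]$ the minimum $z^c_I$ of $\sum_{i\in I}x_i$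 over $\mathsf{As}^c_{n-1}$ exists (the tight value); one has $\mathsf{As}^c_{n-1}=P_n(\{z^c_I\})$, and $z^c_{R_\delta}=w_{R_\delta}$ for every proper diagonal $\delta$. There are unique real numbers $y_I$ $(\varnothing\neq I\subseteq[n])$ with $$\mathsf{As}^c_{n-1}=\sum_{\varnothing\ne I\subseteq[n]}y_I\,\Delta_I,\qquad \Delta_I=\operatorname{conv}\{e_i:i\in I\},$$ as a Minkowski sum and difference, i.e. $\mathsf{As}^c_{n-1}+\sum_{y_I<0}(-y_I)\Delta_I=\sum_{y_I>0}y_I\Delta_I$. For every non-empty $I\subseteq[n]$: * if $v=1$, with $(a,b)$ the only down interval of $I$, $\gamma=\min I$, $\Gamma=\max I$, and $\delta_1=\{a,b\}$, $\delta_2=\{a,\Gamma\}$, $\delta_3=\{\gamma,b\}$, $\delta_4=\{\gamma,\Gamma\}$, then $$y_I=(-1)^{|I\setminus R_{\delta_1}|}\bigl(z^c_{R_{\delta_1}}-z^c_{R_{\delta_2}}-z^c_{R_{\delta_3}}+z^c_{R_{\delta_4}}\bigr);$$ * if $v\neq1$, then $y_I=0$. -/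

import Mathlib

open scoped Pointwise

/-! ### Generalised permutahedra

The ground set `[n] = {1, …, n}` is indexed by `Fin n`; the element with index `i` carries the
label `i + 1`. Labels of polygon vertices are the natural numbers `0, 1, …, n + 1`. -/

/-- The label in `{1, …, n}` of the index `i : Fin n`. -/
def lab {n : ℕ} (i : Fin n) : ℕ := i.val + 1

/-- The polytope `P_n({z_I})`: all `x ∈ ℝⁿ` with `∑_{i ∈ [n]} x_i = z_[n]` and
`∑_{i ∈ I} x_i ≥ z_I` for every non-empty proper subset `I` of `[n]`. -/
def permPolytope {n : ℕ} (z : Finset (Fin n) → ℝ) : Set (Fin n → ℝ) :=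
  {x | ∑ i, x i = z Finset.univ ∧
    ∀ I : Finset (Fin n), I.Nonempty → I ≠ Finset.univ → z I ≤ ∑ i ∈ I, x i}

/-- The right-hand sides `w` lie in the (closed) deformation cone of the classical permutahedron:
no facet-defining hyperplane is moved past a vertex. The vertices of the permutahedron correspond
to the complete flags of subsets of `[n]`, that is, to the orderings `σ` of `[n]`; the hyperplanes
`∑_{i ∈ J} x_i = w_J` belonging to the members `J` of such a flag still have to meet in a point
of `P_n({w_I})`. (The flag includes `∅`, so that `w_∅ = 0`.) -/
def InDeformationCone {n : ℕ} (w : Finset (Fin n) → ℝ) : Prop :=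
  ∀ σ : Equiv.Perm (Fin n), ∃ x ∈ permPolytope w, ∀ k : ℕ,
    ∑ i ∈ Finset.univ.filter (fun i : Fin n => (σ i).val < k), x i =
      w (Finset.univ.filter (fun i : Fin n => (σ i).val < k))

/-- `z_I` is the tight value of the inequality `∑_{i ∈ I} x_i ≥ z_I` for `P`, for every `I`:
the minimum of `∑_{i ∈ I} x_i` over `P` exists and equals `z_I`. -/
def IsTight {n : ℕ} (P : Set (Fin n → ℝ)) (z : Finset (Fin n) → ℝ) : Prop :=
  ∀ I : Finset (Fin n), IsLeast ((fun x : Fin n → ℝ => ∑ i ∈ I, x i) '' P) (z I)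

/-- The face `Δ_I = conv {e_i : i ∈ I}` of the standard simplex. -/
def simplexFace {n : ℕ} (I : Finset (Fin n)) : Set (Fin n → ℝ) :=
  convexHull ℝ ((fun i : Fin n => (Pi.single i 1 : Fin n → ℝ)) '' (I : Set (Fin n)))

/-- `P = ∑_I y_I Δ_I` as a Minkowski sum and difference, `I` running over the non-empty subsets of
`[n]`. As `P - Q = R` means `P = Q + R`, the terms with negative coefficient stand on the side
of `P`. -/
def IsMinkowskiDecomposition {n : ℕ} (P : Set (Fin n → ℝ)) (y : Finset (Fin n) → ℝ) : Prop :=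
  P + ∑ I ∈ Finset.univ.filter (fun I : Finset (Fin n) => I.Nonempty),
      max (-y I) 0 • simplexFace I =
    ∑ I ∈ Finset.univ.filter (fun I : Finset (Fin n) => I.Nonempty),
      max (y I) 0 • simplexFace I

/-! ### The labelled polygon -/

/-- A partition of `[n]` into an up set and a down set (equivalently a Coxeter element `c` of the
symmetric group), given by its up set. The down set contains `1` and `n`. -/
structure UpDownPartition (n : ℕ) where
  up : Finset ℕ
  up_bounds : ∀ u ∈ up, 1 < u ∧ u < n

namespace UpDownPartition

variable {n : ℕ} (c : UpDownPartition n)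

/-- The extended down set: the down set together with `0` and `n + 1`. -/
def downBar : Finset ℕ := Finset.range (n + 2) \ c.up

/-- The position of the label `x` when the vertices of the `(n+2)`-gon are numbered
counter-clockwise by `0, 1, …, n + 1`, starting at the vertex with label `0`: first the extended
down set in increasing order, from `0` to `n + 1`, then the up set in decreasing order. -/
def pos (x : ℕ) : ℕ :=
  if x ∈ c.up then c.downBar.card + (c.up.filter (fun u => x < u)).card
  else (c.downBar.filter (fun d => d < x)).card

/-- The vertex `v` lies strictly to the right of the oriented diagonal from `x` to `y`: in
counter-clockwise direction one meets `v` strictly after `x` and strictly before `y`. -/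
def IsRightOf (x y v : ℕ) : Prop :=
  (c.pos x < c.pos v ∧ c.pos v < c.pos y) ∨
  (c.pos v < c.pos y ∧ c.pos y < c.pos x) ∨
  (c.pos y < c.pos x ∧ c.pos x < c.pos v)

instance (x y v : ℕ) : Decidable (c.IsRightOf x y v) := by
  unfold IsRightOf; infer_instance

/-- The vertices `x` and `y` are joined by an edge of the polygon. -/
def IsAdjacent (x y : ℕ) : Prop :=
  (c.pos x + 1) % (n + 2) = c.pos y ∨ (c.pos y + 1) % (n + 2) = c.pos x

instance (x y : ℕ) : Decidable (c.IsAdjacent x y) := by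
  unfold IsAdjacent; infer_instance

/-- `{x, y}`, with smaller label `x` and larger label `y`, is a proper diagonal. -/
def IsProperDiagonal (x y : ℕ) : Prop := x < y ∧ y ≤ n + 1 ∧ ¬ c.IsAdjacent x y

instance (x y : ℕ) : Decidable (c.IsProperDiagonal x y) := by
  unfold IsProperDiagonal; infer_instance

/-- The set `R_δ ⊆ [n]` of the diagonal `δ = {x, y}`, `x ≤ y`. For a proper diagonal, oriented from
`x` to `y`, it consists of the labels strictly to the right, where `0` is replaced by `x` if `x` is
in the up set and `n + 1` is replaced by `y` if `y` is in the up set (and `0`, `n + 1` are dropped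
otherwise). For an edge or a degenerate diagonal, it is `∅` or `[n]` by convention. -/
def R (x y : ℕ) : Finset (Fin n) :=
  if c.IsProperDiagonal x y then
    Finset.univ.filter (fun i : Fin n =>
      c.IsRightOf x y (lab i) ∨
      (lab i = x ∧ x ∈ c.up ∧ c.IsRightOf x y 0) ∨
      (lab i = y ∧ y ∈ c.up ∧ c.IsRightOf x y (n + 1)))
  else if x = 0 ∧ y = n + 1 ∧ c.up = ∅ then Finset.univ
  else if x ∉ c.up ∧ y ∉ c.up then ∅
  else Finset.univ

/-- The associahedron obtained from `P_n({w_I})` by dropping all inequalities that do not belong to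
a proper diagonal of the labelled polygon. -/
def associahedron (w : Finset (Fin n) → ℝ) : Set (Fin n → ℝ) :=
  {x | ∑ i, x i = w Finset.univ ∧
    ∀ a b : ℕ, c.IsProperDiagonal a b → w (c.R a b) ≤ ∑ i ∈ c.R a b, x i}

/-! ### Up and down interval decomposition -/

/-- The open down interval `(a, b)_D`: the elements of the down set strictly between `a`
and `b`. -/
def downInterval (a b : ℕ) : Finset (Fin n) :=
  Finset.univ.filter (fun i : Fin n => lab i ∉ c.up ∧ a < lab i ∧ lab i < b)

/-- The down intervals `(a, b)_D` of the up and down interval decomposition of `I`, recorded by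
their end-points `a < b` in the extended down set. They are
* the non-empty inclusion-maximal down intervals contained in `I` (maximality says that neither
  end-point is in `I`), and
* the empty down intervals, `a` and `b` being consecutive elements of the extended down set that are
  not in `I`, for which the open interval `(a, b)` of `[n]` contains an up interval of `I`, that is,
  contains an element of `I` from the up set. -/
def downIntervals (I : Finset (Fin n)) : Finset (ℕ × ℕ) :=
  (c.downBar ×ˢ c.downBar).filter (fun p =>
    p.1 < p.2 ∧
    (∀ i ∈ I, lab i ≠ p.1 ∧ lab i ≠ p.2) ∧
    (((c.downInterval p.1 p.2).Nonempty ∧ c.downInterval p.1 p.2 ⊆ I) ∨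
      (c.downInterval p.1 p.2 = ∅ ∧ ∃ i ∈ I, lab i ∈ c.up ∧ p.1 < lab i ∧ lab i < p.2)))

end UpDownPartition

/-! ### Supermodular set functions -/

/-! The proof guesses the tight values in closed form and then verifies them.

Encode `I` by a path of labels from `0` to `n + 1` in increasing order, passing through the up
labels in `I` and the down labels not in `I` (`pathSet`). The candidate is `z_I = ∑ w (R_{pq}) - |I
∩ U| · w_[n]`, the sum running over consecutive labels `p < q` of the path. In `edgeWeight` the
correction is split into halves between the two path edges at each up label. If `w` is additive,
inserting a label into the path changes the sum by plus or minus one coordinate, so the formula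
returns `w` itself (`tightValue_modular`). Applied to a point `x` of the associahedron, a termwise
comparison shows that `z_I` is a valid lower bound (`tightValue_le`). The path of `R_δ` consists of
`δ` and polygon edges, so `z` agrees with `w` there (`tightValue_R`). Hence the associahedron is
`permPolytope z`.

It remains to see that `z` is supermodular, since base polytopes of supermodular functions are
tight, determine their function and add under Minkowski sum. A mixed second difference of a path sum
involves only four diagonals on labels `p < i < j < q`, and the corresponding sets `R` are related
by union and intersection. Supermodularity of `w` then gives the inequality (`le_of_same_type`,
`le_of_mixed_type`).

Consequently a Minkowski decomposition is the same as an expression `z_I = ∑_{J ⊆ I} y_J`, and `y`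
is the Möbius inverse of `z`. That `p < q` are consecutive on the path of `I` means that `I`
contains one fixed set and avoids another, and the Möbius inverse of such an indicator is explicit
(`sum_powerset_intervalCoeff`). For given `J` the pairs that contribute exist only if `J` has a
single down interval `(a, b)`; they then have `p ∈ {a, γ}` and `q ∈ {b, Γ}`, which produces the
four-term formula. -/

/-- Supermodular set functions. -/
def Supermodular {n : ℕ} (z : Finset (Fin n) → ℝ) : Prop :=
  ∀ A B : Finset (Fin n), z A + z B ≤ z (A ∪ B) + z (A ∩ B)

/-- The set function `I ↦ ∑_{J ⊆ I} t_J`, `J` running over the non-empty sets. -/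
noncomputable def zetaSum {n : ℕ} (t : Finset (Fin n) → ℝ) (I : Finset (Fin n)) : ℝ :=
  ∑ J ∈ Finset.univ.filter (fun J : Finset (Fin n) => J.Nonempty), if J ⊆ I then t J else 0

section Supermodular

variable {n : ℕ}

/-- The local inequality says that the marginal gain of `i` does not drop when one element is added.
Adding elements one at a time extends this first to larger base sets (`incr`), then to larger
increments (`key`). -/
theorem supermodular_of_local (z : Finset (Fin n) → ℝ)
    (h : ∀ (I : Finset (Fin n)) (i j : Fin n), i < j → i ∉ I → j ∉ I →
      z (insert i I) + z (insert j I) ≤ z (insert i (insert j I)) + z I) :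
    Supermodular z := by
  have h' : ∀ (I : Finset (Fin n)) (i j : Fin n), i ≠ j → i ∉ I → j ∉ I →
      z (insert i I) + z (insert j I) ≤ z (insert i (insert j I)) + z I := by
    intro I i j hij hi hj
    rcases lt_or_gt_of_ne hij with hlt | hlt
    · exact h I i j hlt hi hj
    · have := h I j i hlt hj hi
      rw [Finset.insert_comm] at this
      linarith
  have incr : ∀ (T A : Finset (Fin n)) (i : Fin n), i ∉ A → i ∉ T →
      z (insert i A) + z (A ∪ T) ≤ z (insert i (A ∪ T)) + z A := by
    intro T
    induction T using Finset.induction_on with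
    | empty => intro A i _ _; simp
    | insert j T hj ih =>
      intro A i hA hT
      simp only [Finset.mem_insert, not_or] at hT
      have h1 := ih A i hA hT.2
      rw [Finset.union_insert]
      by_cases hjA : j ∈ A ∪ T
      · rw [Finset.insert_eq_of_mem hjA]; exact h1
      · have h2 := h' (A ∪ T) i j hT.1 (by simp [hA, hT.2]) hjA
        linarith
  have key : ∀ (T A C : Finset (Fin n)), C ⊆ A → Disjoint T A →
      z (C ∪ T) + z A ≤ z (A ∪ T) + z C := by
    intro T
    induction T using Finset.induction_on with
    | empty => intro A C _ _; simp [add_comm]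
    | insert j T hj ih =>
      intro A C hC hT
      rw [Finset.disjoint_insert_left] at hT
      have h1 := ih A C hC hT.2
      have h2 := incr (A \ C) (C ∪ T) j
        (by simp only [Finset.mem_union, not_or]; exact ⟨fun hh => hT.1 (hC hh), hj⟩)
        (by simp [hT.1])
      have e : C ∪ T ∪ (A \ C) = A ∪ T := by
        ext x
        have := @hC x
        simp only [Finset.mem_union, Finset.mem_sdiff]
        tauto
      rw [e] at h2
      rw [Finset.union_insert, Finset.union_insert]
      linarith
  intro A B
  have := key (B \ A) A (A ∩ B) Finset.inter_subset_left Finset.sdiff_disjoint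
  have e1 : A ∩ B ∪ B \ A = B := by
    ext x; simp only [Finset.mem_union, Finset.mem_inter, Finset.mem_sdiff]; tauto
  rw [e1, Finset.union_sdiff_self_eq_union] at this
  linarith

theorem Supermodular.add {z z' : Finset (Fin n) → ℝ} (h : Supermodular z) (h' : Supermodular z') :
    Supermodular (z + z') := by
  intro A B
  have := h A B
  have := h' A B
  simp only [Pi.add_apply]
  linarith

theorem Supermodular.sum {ι : Type*} (s : Finset ι) {z : ι → Finset (Fin n) → ℝ}
    (h : ∀ i ∈ s, Supermodular (z i)) : Supermodular (∑ i ∈ s, z i) := by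
  classical
  induction s using Finset.induction_on with
  | empty => intro A B; simp
  | insert i s hi ih =>
    rw [Finset.sum_insert hi]
    exact (h i (by simp)).add (ih fun j hj => h j (by simp [hj]))

theorem supermodular_subset_indicator (J : Finset (Fin n)) {t : ℝ} (ht : 0 ≤ t) :
    Supermodular (fun I => if J ⊆ I then t else 0) := by
  intro A B
  by_cases hA : J ⊆ A
  · by_cases hB : J ⊆ B
    · simp [hA, hB, Finset.subset_inter hA hB, hA.trans Finset.subset_union_left]
    · simp only [hA, hB, hA.trans Finset.subset_union_left, if_true, if_false]
      split_ifs <;> linarith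
  · by_cases hB : J ⊆ B
    · simp only [hA, hB, hB.trans Finset.subset_union_right, if_true, if_false]
      split_ifs <;> linarith
    · simp only [hA, hB, if_false]
      split_ifs <;> linarith

/-! ### Orderings and flags -/

/-- The initial segments of an ordering sorting `f` contain all sublevel sets of `f`. -/
theorem exists_perm_sublevel {α : Type*} [LinearOrder α] (f : Fin n → α) :
    ∃ σ : Equiv.Perm (Fin n), (∀ i j, σ i ≤ σ j → f i ≤ f j) ∧
      ∀ a : α, ∃ k : ℕ, Finset.univ.filter (fun i => f i ≤ a) =
        Finset.univ.filter (fun i : Fin n => (σ i).val < k) := by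
  refine ⟨(Tuple.sort f)⁻¹, ?_, ?_⟩
  · intro i j hij
    have := Tuple.monotone_sort f hij
    simpa using this
  · intro a
    refine ⟨(Finset.univ.filter fun i => (f ∘ Tuple.sort f) i ≤ a).card, ?_⟩
    ext i
    have := Tuple.lt_card_le_iff_apply_le_of_monotone (f := f ∘ Tuple.sort f) (a := a)
      (h_sorted := Tuple.monotone_sort f) (j := (Tuple.sort f)⁻¹ i)
    simp only [Finset.mem_filter, Finset.mem_univ, true_and]
    rw [this]
    simp

theorem InDeformationCone.map_empty {w : Finset (Fin n) → ℝ} (hw : InDeformationCone w) :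
    w ∅ = 0 := by
  obtain ⟨x, -, hx⟩ := hw 1
  simpa using (hx 0).symm

/-- Take a flag through `A ∩ B` and `A ∪ B`. Its point `x` attains `w` on these two sets and
dominates `w` on `A` and `B`, while `x` itself is additive. -/
theorem InDeformationCone.supermodular {w : Finset (Fin n) → ℝ} (hw : InDeformationCone w) :
    Supermodular w := by
  intro A B
  obtain ⟨σ, -, hσ⟩ := exists_perm_sublevel
    (fun i : Fin n => if i ∈ A ∩ B then 0 else if i ∈ A ∪ B then 1 else (2 : ℕ))
  obtain ⟨x, ⟨hx1, hx2⟩, hx⟩ := hw σ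
  have h0 := hw.map_empty
  have hge : ∀ I : Finset (Fin n), w I ≤ ∑ i ∈ I, x i := by
    intro I
    rcases I.eq_empty_or_nonempty with rfl | hI
    · simp [h0]
    · by_cases hu : I = Finset.univ
      · rw [hu, hx1]
      · exact hx2 I hI hu
  obtain ⟨k, hk⟩ := hσ 0
  obtain ⟨l, hl⟩ := hσ 1
  have e1 : Finset.univ.filter (fun i : Fin n => (σ i).val < k) = A ∩ B := by
    rw [← hk]
    ext i
    simp only [Finset.mem_filter, Finset.mem_univ, true_and]
    split_ifs <;> simp_all
  have e2 : Finset.univ.filter (fun i : Fin n => (σ i).val < l) = A ∪ B := by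
    rw [← hl]
    ext i
    simp only [Finset.mem_filter, Finset.mem_univ, true_and]
    split_ifs <;> simp_all
  have h1 := hx k
  have h2 := hx l
  rw [e1] at h1
  rw [e2] at h2
  have := Finset.sum_union_inter (s₁ := A) (s₂ := B) (f := x)
  linarith [hge A, hge B]

/-! ### Base polytopes -/

theorem le_sum_of_mem_permPolytope {z : Finset (Fin n) → ℝ} (h0 : z ∅ = 0) {x : Fin n → ℝ}
    (hx : x ∈ permPolytope z) (I : Finset (Fin n)) : z I ≤ ∑ i ∈ I, x i := by
  rcases I.eq_empty_or_nonempty with rfl | hI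
  · simp [h0]
  · by_cases hu : I = Finset.univ
    · rw [hu, hx.1]
    · exact hx.2 I hI hu

/-- The vertex of the base polytope of `z` belonging to an ordering. -/
def greedyVertex (z : Finset (Fin n) → ℝ) (σ : Equiv.Perm (Fin n)) (i : Fin n) : ℝ :=
  z (Finset.univ.filter fun j : Fin n => (σ j).val < (σ i).val + 1) -
    z (Finset.univ.filter fun j : Fin n => (σ j).val < (σ i).val)

theorem filter_perm_lt_succ (σ : Equiv.Perm (Fin n)) (k : Fin n) :
    (Finset.univ.filter fun j : Fin n => (σ j).val < k.val + 1) =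
      insert (σ.symm k) (Finset.univ.filter fun j : Fin n => (σ j).val < k.val) := by
  ext j
  simp only [Finset.mem_filter, Finset.mem_univ, true_and, Finset.mem_insert,
    Equiv.eq_symm_apply, Fin.ext_iff]
  omega

theorem filter_perm_eq_univ (σ : Equiv.Perm (Fin n)) :
    (Finset.univ.filter fun j : Fin n => (σ j).val < n) = Finset.univ := by
  ext j; simp

theorem sum_greedyVertex (z : Finset (Fin n) → ℝ) (h0 : z ∅ = 0) (σ : Equiv.Perm (Fin n))
    (k : ℕ) (hk : k ≤ n) :
    ∑ i ∈ Finset.univ.filter (fun i : Fin n => (σ i).val < k), greedyVertex z σ i =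
      z (Finset.univ.filter (fun i : Fin n => (σ i).val < k)) := by
  induction k with
  | zero => simp [h0]
  | succ k ih =>
    have hkn : k < n := hk
    have e := filter_perm_lt_succ σ ⟨k, hkn⟩
    simp only at e
    rw [e, Finset.sum_insert (by simp), ih hkn.le, ← e]
    simp [greedyVertex]

/-- Build up `I` along the ordering. Each new element contributes to `z` at most its marginal gain
over the whole initial segment, which is its coordinate in the greedy vertex. -/
theorem le_sum_greedyVertex {z : Finset (Fin n) → ℝ} (h0 : z ∅ = 0) (hz : Supermodular z)
    (σ : Equiv.Perm (Fin n)) (I : Finset (Fin n)) :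
    z I ≤ ∑ i ∈ I, greedyVertex z σ i := by
  have key : ∀ k : ℕ, k ≤ n →
      z (I ∩ Finset.univ.filter (fun i : Fin n => (σ i).val < k)) ≤
      ∑ i ∈ I ∩ Finset.univ.filter (fun i : Fin n => (σ i).val < k), greedyVertex z σ i := by
    intro k hk
    induction k with
    | zero => simp [h0]
    | succ k ih =>
      have hkn : k < n := hk
      have e := filter_perm_lt_succ σ ⟨k, hkn⟩
      simp only at e
      have ih := ih hkn.le
      set F := Finset.univ.filter (fun i : Fin n => (σ i).val < k) with hF
      set j := σ.symm ⟨k, hkn⟩ with hj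
      have hjF : j ∉ F := by simp [hF, hj]
      by_cases hjI : j ∈ I
      · have hg : greedyVertex z σ j = z (insert j F) - z F := by
          have hσj : (σ j).val = k := by simp [hj]
          simp only [greedyVertex, hσj, e, hF]
        rw [e, Finset.inter_insert_of_mem hjI, Finset.sum_insert (by simp [hjF]), hg]
        have := hz (insert j (I ∩ F)) F
        have e1 : insert j (I ∩ F) ∪ F = insert j F := by
          ext x; simp only [Finset.mem_union, Finset.mem_insert, Finset.mem_inter]; tauto
        have e2 : insert j (I ∩ F) ∩ F = I ∩ F := by
          ext x
          simp only [Finset.mem_insert, Finset.mem_inter]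
          constructor
          · rintro ⟨rfl | h, h2⟩
            · exact absurd h2 hjF
            · exact h
          · tauto
        rw [e1, e2] at this
        linarith
      · rw [e, Finset.inter_insert_of_notMem hjI]
        exact ih
  have := key n le_rfl
  rwa [filter_perm_eq_univ, Finset.inter_univ] at this

theorem greedyVertex_mem {z : Finset (Fin n) → ℝ} (h0 : z ∅ = 0) (hz : Supermodular z)
    (σ : Equiv.Perm (Fin n)) : greedyVertex z σ ∈ permPolytope z := by
  refine ⟨?_, fun I _ _ => le_sum_greedyVertex h0 hz σ I⟩
  have := sum_greedyVertex z h0 σ n le_rfl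
  rwa [filter_perm_eq_univ] at this

theorem isTight_permPolytope {z : Finset (Fin n) → ℝ} (h0 : z ∅ = 0) (hz : Supermodular z) :
    IsTight (permPolytope z) z := by
  intro I
  refine ⟨?_, ?_⟩
  · obtain ⟨σ, -, hσ⟩ := exists_perm_sublevel (fun i : Fin n => if i ∈ I then 0 else (1 : ℕ))
    obtain ⟨k, hk⟩ := hσ 0
    -- The ordering lists `I` first, so the greedy vertex attains `z I`. The length `k` comes
    -- without a bound and is capped at `n` for `sum_greedyVertex`.
    have e : Finset.univ.filter (fun i : Fin n => (σ i).val < min k n) = I := by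
      ext i
      have := Finset.ext_iff.1 hk i
      simp only [Finset.mem_filter, Finset.mem_univ, true_and] at this ⊢
      have hlt := (σ i).isLt
      rw [lt_min_iff, ← this]
      simp
    refine ⟨greedyVertex z σ, greedyVertex_mem h0 hz σ, ?_⟩
    have := sum_greedyVertex z h0 σ (min k n) (min_le_right _ _)
    rw [e] at this
    exact this
  · rintro _ ⟨x, hx, rfl⟩
    exact le_sum_of_mem_permPolytope h0 hx I

theorem permPolytope_injective {z z' : Finset (Fin n) → ℝ} (h0 : z ∅ = 0) (hz : Supermodular z)
    (h0' : z' ∅ = 0) (hz' : Supermodular z') (h : permPolytope z = permPolytope z') : z = z' := by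
  funext I
  have h1 := isTight_permPolytope h0 hz I
  have h2 := isTight_permPolytope h0' hz' I
  rw [h] at h1
  exact h1.unique h2

/-- The greedy vertex minimises every linear functional whose coefficients decrease along the
ordering. -/
theorem sum_mul_greedyVertex_le {z : Finset (Fin n) → ℝ} (h0 : z ∅ = 0) (σ : Equiv.Perm (Fin n))
    (f : Fin n → ℝ) (hf : ∀ i j, σ i ≤ σ j → f j ≤ f i) {x : Fin n → ℝ}
    (hx : x ∈ permPolytope z) :
    ∑ i, f i * greedyVertex z σ i ≤ ∑ i, f i * x i := by
  set d : Fin n → ℝ := fun i => x i - greedyVertex z σ i with hd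
  have hdk : ∀ k ≤ n, 0 ≤ ∑ i ∈ Finset.univ.filter (fun i : Fin n => (σ i).val < k), d i := by
    intro k hk
    rw [hd, Finset.sum_sub_distrib, sum_greedyVertex z h0 σ k hk, sub_nonneg]
    exact le_sum_of_mem_permPolytope h0 hx _
  have htot : ∑ i, d i = 0 := by
    have := sum_greedyVertex z h0 σ n le_rfl
    rw [filter_perm_eq_univ] at this
    rw [hd, Finset.sum_sub_distrib, this, hx.1, sub_self]
  -- Abel summation: the partial sums of `d` are nonnegative and `f` decreases along the ordering;
  -- the total of `d` is zero, so the last boundary term vanishes.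
  have key : ∀ k : ℕ, ∀ hk : k < n,
      f (σ.symm ⟨k, hk⟩) * ∑ i ∈ Finset.univ.filter (fun i : Fin n => (σ i).val < k + 1), d i ≤
      ∑ i ∈ Finset.univ.filter (fun i : Fin n => (σ i).val < k + 1), f i * d i := by
    intro k
    induction k with
    | zero =>
      intro hk
      have e := filter_perm_lt_succ σ ⟨0, hk⟩
      simp only at e
      rw [e]
      simp
    | succ k ih =>
      intro hk
      have e := filter_perm_lt_succ σ ⟨k + 1, hk⟩
      simp only at e
      rw [e, Finset.sum_insert (by simp), Finset.sum_insert (by simp), mul_add]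
      have h1 := ih (by omega)
      have h2 := hdk (k + 1) hk.le
      have h3 := hf (σ.symm ⟨k, by omega⟩) (σ.symm ⟨k + 1, hk⟩) (by simp)
      have := mul_le_mul_of_nonneg_right h3 h2
      linarith
  have hfin : 0 ≤ ∑ i, f i * d i := by
    rcases Nat.eq_zero_or_pos n with rfl | hn
    · simp
    · obtain ⟨m, rfl⟩ : ∃ m, n = m + 1 := ⟨n - 1, by omega⟩
      have := key m (by omega)
      rwa [filter_perm_eq_univ, htot, mul_zero] at this
  have : ∑ i, f i * d i = ∑ i, f i * x i - ∑ i, f i * greedyVertex z σ i := by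
    rw [← Finset.sum_sub_distrib]
    exact Finset.sum_congr rfl fun i _ => by simp only [hd]; ring
  linarith

theorem isClosed_permPolytope (z : Finset (Fin n) → ℝ) : IsClosed (permPolytope z) := by
  have : permPolytope z = {x | ∑ i, x i = z Finset.univ} ∩
      ⋂ (I : Finset (Fin n)) (_ : I.Nonempty) (_ : I ≠ Finset.univ),
        {x : Fin n → ℝ | z I ≤ ∑ i ∈ I, x i} := by
    ext x; simp [permPolytope]
  rw [this]
  refine (isClosed_eq (by fun_prop) continuous_const).inter ?_
  exact isClosed_iInter fun I => isClosed_iInter fun _ => isClosed_iInter fun _ =>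
    isClosed_le continuous_const (by fun_prop)

theorem convex_permPolytope (z : Finset (Fin n) → ℝ) : Convex ℝ (permPolytope z) := by
  intro x hx y hy a b ha hb hab
  have e : ∀ I : Finset (Fin n), ∑ i ∈ I, (a • x + b • y) i =
      a * ∑ i ∈ I, x i + b * ∑ i ∈ I, y i := by
    intro I
    simp [Finset.sum_add_distrib, Finset.mul_sum]
  refine ⟨?_, fun I h1 h2 => ?_⟩
  · rw [e, hx.1, hy.1, ← add_mul, hab, one_mul]
  · rw [e]
    have h3 := mul_le_mul_of_nonneg_left (hx.2 I h1 h2) ha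
    have h4 := mul_le_mul_of_nonneg_left (hy.2 I h1 h2) hb
    have : z I = a * z I + b * z I := by rw [← add_mul, hab, one_mul]
    linarith

theorem isCompact_permPolytope {z : Finset (Fin n) → ℝ} (h0 : z ∅ = 0) :
    IsCompact (permPolytope z) := by
  refine IsCompact.of_isClosed_subset
    (isCompact_Icc (a := fun i => z {i}) (b := fun i => z Finset.univ - z (Finset.univ.erase i)))
    (isClosed_permPolytope z) ?_
  intro x hx
  refine ⟨fun i => ?_, fun i => ?_⟩
  · simpa using le_sum_of_mem_permPolytope h0 hx {i}
  · have h1 := le_sum_of_mem_permPolytope h0 hx (Finset.univ.erase i)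
    have h2 := Finset.add_sum_erase Finset.univ x (Finset.mem_univ i)
    have h3 := hx.1
    simp only
    linarith

/-- For the nontrivial inclusion, separate a hypothetical point outside the sum by a functional.
Order the coordinates by decreasing coefficient. The greedy vertices of `z` and `z'` for this
ordering add up to that of `z + z'`, which minimises the functional on the right-hand polytope, a
contradiction. -/
theorem permPolytope_add {z z' : Finset (Fin n) → ℝ} (h0 : z ∅ = 0) (hz : Supermodular z)
    (h0' : z' ∅ = 0) (hz' : Supermodular z') :
    permPolytope z + permPolytope z' = permPolytope (z + z') := by
  apply Set.Subset.antisymm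
  · rintro _ ⟨x, hx, y, hy, rfl⟩
    refine ⟨?_, fun I h1 h2 => ?_⟩
    · simp only [Pi.add_apply, Finset.sum_add_distrib, hx.1, hy.1]
    · simp only [Pi.add_apply, Finset.sum_add_distrib]
      exact add_le_add (hx.2 I h1 h2) (hy.2 I h1 h2)
  · intro y hy
    by_contra hny
    obtain ⟨φ, u, hu1, hu2⟩ := geometric_hahn_banach_point_closed
      ((convex_permPolytope z).add (convex_permPolytope z'))
      ((isCompact_permPolytope h0).add (isCompact_permPolytope h0')).isClosed hny
    have hφ : ∀ x, φ x = ∑ i, φ (Pi.single i 1) * x i := by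
      intro x
      conv_lhs => rw [pi_eq_sum_univ' x]
      rw [map_sum]
      refine Finset.sum_congr rfl fun i _ => ?_
      rw [map_smul, smul_eq_mul, mul_comm]
    obtain ⟨σ, hσ, -⟩ := exists_perm_sublevel (fun i => OrderDual.toDual (φ (Pi.single i 1)))
    have h1 := sum_mul_greedyVertex_le (z := z + z') (by simp [h0, h0']) σ
      (fun i => φ (Pi.single i 1)) (fun i j hij => hσ i j hij) hy
    have h2 := hu2 _ (Set.add_mem_add (greedyVertex_mem h0 hz σ) (greedyVertex_mem h0' hz' σ))
    have e : greedyVertex z σ + greedyVertex z' σ = greedyVertex (z + z') σ := by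
      funext i
      simp only [greedyVertex, Pi.add_apply]
      ring
    rw [e, hφ] at h2
    rw [hφ] at hu1
    linarith

theorem permPolytope_zero : permPolytope (0 : Finset (Fin n) → ℝ) = 0 := by
  ext x
  simp only [Set.mem_zero]
  constructor
  · intro hx
    have h1 : ∀ i ∈ Finset.univ, 0 ≤ x i := fun i _ => by
      simpa using le_sum_of_mem_permPolytope rfl hx {i}
    funext i
    exact (Finset.sum_eq_zero_iff_of_nonneg h1).1 hx.1 i (Finset.mem_univ i)
  · rintro rfl
    simp [permPolytope]

theorem sum_permPolytope {ι : Type*} (s : Finset ι) {z : ι → Finset (Fin n) → ℝ}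
    (h0 : ∀ i ∈ s, z i ∅ = 0) (h : ∀ i ∈ s, Supermodular (z i)) :
    ∑ i ∈ s, permPolytope (z i) = permPolytope (∑ i ∈ s, z i) := by
  classical
  induction s using Finset.induction_on with
  | empty => simp [permPolytope_zero]
  | insert i s hi ih =>
    have h0s : ∀ j ∈ s, z j ∅ = 0 := fun j hj => h0 j (by simp [hj])
    have hs : ∀ j ∈ s, Supermodular (z j) := fun j hj => h j (by simp [hj])
    rw [Finset.sum_insert hi, Finset.sum_insert hi, ih h0s hs]
    exact permPolytope_add (h0 i (by simp)) (h i (by simp))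
      (by simpa using Finset.sum_eq_zero h0s) (Supermodular.sum s hs)

/-! ### Minkowski decompositions -/

/-- The inequalities for singletons, for `J` and for `[n]` force nonnegative coordinates with sum
`t` supported on `J`. -/
theorem smul_simplexFace {J : Finset (Fin n)} (hJ : J.Nonempty) {t : ℝ} (ht : 0 ≤ t) :
    t • simplexFace J = permPolytope (fun I => if J ⊆ I then t else 0) := by
  have h0 : (if J ⊆ (∅ : Finset (Fin n)) then t else 0) = 0 := by
    rw [if_neg]
    rw [Finset.subset_empty]
    exact hJ.ne_empty
  apply Set.Subset.antisymm
  · rintro _ ⟨x, hx, rfl⟩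
    have hsub : simplexFace J ⊆ permPolytope (fun I => if J ⊆ I then 1 else 0) := by
      refine convexHull_min ?_ (convex_permPolytope _)
      rintro _ ⟨i, hi, rfl⟩
      refine ⟨by simp, fun I _ _ => ?_⟩
      have hs : ∑ k ∈ I, (Pi.single i 1 : Fin n → ℝ) k = if i ∈ I then 1 else 0 := by
        simp [Pi.single_apply]
      simp only [hs]
      by_cases hJI : J ⊆ I
      · rw [if_pos hJI, if_pos (hJI hi)]
      · simp only [hJI, if_false]
        split_ifs <;> simp
    have hx := hsub hx
    refine ⟨?_, fun I h1 h2 => ?_⟩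
    · have := hx.1
      simp only [Pi.smul_apply, smul_eq_mul, ← Finset.mul_sum, this]
      simp
    · have := mul_le_mul_of_nonneg_left (hx.2 I h1 h2) ht
      simpa [← Finset.mul_sum] using this
  · intro x hx
    have hle := le_sum_of_mem_permPolytope h0 hx
    have hnn : ∀ i, 0 ≤ x i := by
      intro i
      have := hle {i}
      simp only [Finset.sum_singleton] at this
      refine le_trans ?_ this
      split_ifs <;> linarith
    have htot : ∑ i, x i = t := by simpa using hx.1
    have hJs : ∑ i ∈ J, x i = t := by
      apply le_antisymm
      · rw [← htot]
        exact Finset.sum_le_sum_of_subset_of_nonneg (Finset.subset_univ _) fun i _ _ => hnn i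
      · simpa using hle J
    have hout : ∀ i, i ∉ J → x i = 0 := by
      have h1 : ∑ i ∈ Finset.univ \ J, x i = 0 := by
        have := Finset.sum_sdiff (Finset.subset_univ J) (f := x)
        linarith
      intro i hi
      exact (Finset.sum_eq_zero_iff_of_nonneg fun j _ => hnn j).1 h1 i (by simp [hi])
    have hxe : x = ∑ i ∈ J, x i • (Pi.single i 1 : Fin n → ℝ) := by
      funext j
      simp only [Finset.sum_apply, Pi.smul_apply, smul_eq_mul, Pi.single_apply, mul_ite, mul_one,
        mul_zero, Finset.sum_ite_eq]
      split_ifs with hj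
      · rfl
      · exact hout j hj
    -- The convex coefficients are `x i / t`, so `t = 0` is treated apart.
    rcases ht.eq_or_lt with rfl | htp
    · have hx0 : x = 0 := by
        funext i
        exact (Finset.sum_eq_zero_iff_of_nonneg fun j _ => hnn j).1 htot i (Finset.mem_univ i)
      obtain ⟨i, hi⟩ := hJ
      exact ⟨Pi.single i 1, subset_convexHull _ _ ⟨i, hi, rfl⟩, by simp [hx0]⟩
    · refine ⟨∑ i ∈ J, (x i / t) • (Pi.single i 1 : Fin n → ℝ), ?_, ?_⟩
      · refine (convex_convexHull ℝ _).sum_mem (fun i _ => div_nonneg (hnn i) ht) ?_ ?_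
        · rw [← Finset.sum_div, hJs, div_self htp.ne']
        · intro i hi
          exact subset_convexHull _ _ ⟨i, hi, rfl⟩
      · simp only [Finset.smul_sum, smul_smul]
        conv_rhs => rw [hxe]
        refine Finset.sum_congr rfl fun i _ => ?_
        rw [mul_div_cancel₀ _ htp.ne']

theorem zetaSum_empty (t : Finset (Fin n) → ℝ) : zetaSum t ∅ = 0 := by
  refine Finset.sum_eq_zero fun J hJ => ?_
  rw [if_neg]
  rw [Finset.subset_empty]
  exact (Finset.mem_filter.1 hJ).2.ne_empty

theorem zetaSum_eq_sum (t : Finset (Fin n) → ℝ) :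
    zetaSum t = ∑ J ∈ Finset.univ.filter (fun J : Finset (Fin n) => J.Nonempty),
      fun I => if J ⊆ I then t J else 0 := by
  funext I
  rw [zetaSum, Finset.sum_apply]

theorem supermodular_zetaSum {t : Finset (Fin n) → ℝ} (ht : ∀ J, 0 ≤ t J) :
    Supermodular (zetaSum t) := by
  rw [zetaSum_eq_sum]
  exact Supermodular.sum _ fun J _ => supermodular_subset_indicator J (ht J)

theorem sum_smul_simplexFace {t : Finset (Fin n) → ℝ} (ht : ∀ J, 0 ≤ t J) :
    ∑ J ∈ Finset.univ.filter (fun J : Finset (Fin n) => J.Nonempty), t J • simplexFace J =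
      permPolytope (zetaSum t) := by
  rw [zetaSum_eq_sum, ← sum_permPolytope]
  · exact Finset.sum_congr rfl fun J hJ => smul_simplexFace (Finset.mem_filter.1 hJ).2 (ht J)
  · intro J hJ
    rw [if_neg]
    rw [Finset.subset_empty]
    exact (Finset.mem_filter.1 hJ).2.ne_empty
  · exact fun J _ => supermodular_subset_indicator J (ht J)

theorem zetaSum_injective {t t' : Finset (Fin n) → ℝ} (h : zetaSum t = zetaSum t')
    (I : Finset (Fin n)) (hI : I.Nonempty) : t I = t' I := by
  induction I using Finset.strongInduction with
  | H I ih =>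
    have hmem : I ∈ Finset.univ.filter (fun J : Finset (Fin n) => J.Nonempty) := by simp [hI]
    have h1 := congrFun h I
    rw [zetaSum, zetaSum, ← Finset.add_sum_erase _ _ hmem, ← Finset.add_sum_erase _ _ hmem] at h1
    have h2 : ∑ J ∈ (Finset.univ.filter (fun J : Finset (Fin n) => J.Nonempty)).erase I,
        (if J ⊆ I then t J else 0) =
        ∑ J ∈ (Finset.univ.filter (fun J : Finset (Fin n) => J.Nonempty)).erase I,
        (if J ⊆ I then t' J else 0) := by
      refine Finset.sum_congr rfl fun J hJ => ?_
      simp only [Finset.mem_erase, Finset.mem_filter, Finset.mem_univ, true_and] at hJ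
      split_ifs with hs
      · exact ih J (hs.ssubset_of_ne hJ.1) hJ.2
      · rfl
    rw [h2] at h1
    simpa using h1

/-- Both sides of the Minkowski identity are base polytopes of supermodular functions, so the
identity becomes one between the functions. There the contribution of the negative part of `y`
cancels. -/
theorem isMinkowskiDecomposition_iff {z : Finset (Fin n) → ℝ} (h0 : z ∅ = 0)
    (hz : Supermodular z) (y : Finset (Fin n) → ℝ) :
    IsMinkowskiDecomposition (permPolytope z) y ↔ z = zetaSum y := by
  have hneg : ∀ J, 0 ≤ max (-y J) 0 := fun J => le_max_right _ _
  have hpos : ∀ J, 0 ≤ max (y J) 0 := fun J => le_max_right _ _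
  unfold IsMinkowskiDecomposition
  rw [sum_smul_simplexFace hneg, sum_smul_simplexFace hpos,
    permPolytope_add h0 hz (zetaSum_empty _) (supermodular_zetaSum hneg)]
  have hdiff : zetaSum (fun J => max (y J) 0) =
      zetaSum y + zetaSum (fun J => max (-y J) 0) := by
    funext I
    simp only [zetaSum, Pi.add_apply, ← Finset.sum_add_distrib]
    refine Finset.sum_congr rfl fun J _ => ?_
    split_ifs
    · rcases le_total 0 (y J) with h | h
      · rw [max_eq_left h, max_eq_right (by linarith)]; ring
      · rw [max_eq_right h, max_eq_left (by linarith)]; ring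
    · simp
  rw [hdiff]
  constructor
  · intro h
    have := permPolytope_injective (by simp [h0, zetaSum_empty])
      (hz.add (supermodular_zetaSum hneg)) (by simp [zetaSum_empty])
      (hdiff ▸ supermodular_zetaSum hpos) h
    exact add_right_cancel this
  · intro h
    rw [← h]

end Supermodular

/-! ### Sums over consecutive pairs -/

/-- `p < q` are consecutive elements of `S`. -/
def Consecutive (S : Finset ℕ) (p q : ℕ) : Prop :=
  p ∈ S ∧ q ∈ S ∧ p < q ∧ ∀ r ∈ S, p < r → ¬ r < q

/-- The pairs of consecutive elements of `S`. -/
noncomputable def consecutivePairs (S : Finset ℕ) : Finset (ℕ × ℕ) :=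
  open Classical in (S ×ˢ S).filter fun e => Consecutive S e.1 e.2

/-- The sum of `h` over the pairs of consecutive elements of `S`. -/
noncomputable def pathSum (h : ℕ → ℕ → ℝ) (S : Finset ℕ) : ℝ :=
  ∑ e ∈ consecutivePairs S, h e.1 e.2

theorem mem_consecutivePairs {S : Finset ℕ} {e : ℕ × ℕ} :
    e ∈ consecutivePairs S ↔ Consecutive S e.1 e.2 := by
  simp only [consecutivePairs, Finset.mem_filter, Finset.mem_product]
  exact ⟨fun h => h.2, fun h => ⟨⟨h.1, h.2.1⟩, h⟩⟩

theorem consecutive_insert_iff {S : Finset ℕ} {p r q : ℕ} (h : Consecutive S p q) (hpr : p < r)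
    (hrq : r < q) (a b : ℕ) :
    Consecutive (insert r S) a b ↔
      (a = p ∧ b = r) ∨ (a = r ∧ b = q) ∨ (¬ (a = p ∧ b = q) ∧ Consecutive S a b) := by
  obtain ⟨hp, hq, hpq, hn⟩ := h
  have hr : r ∉ S := fun hr => hn r hr hpr hrq
  have hle : ∀ s ∈ S, s ≤ p ∨ q ≤ s := fun s hs => by
    by_contra hcon
    exact hn s hs (by omega) (by omega)
  constructor
  · rintro ⟨ha, hb, hab, hc⟩
    simp only [Finset.mem_insert] at ha hb
    have hcp := hc p (by simp [hp])
    have hcq := hc q (by simp [hq])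
    have hcr := hc r (by simp)
    rcases ha with rfl | ha
    · rcases hb with rfl | hb
      · omega
      · have := hle b hb
        right; left; omega
    · rcases hb with rfl | hb
      · have := hle a ha
        left; omega
      · refine Or.inr (Or.inr ⟨?_, ha, hb, hab, fun s hs => hc s (by simp [hs])⟩)
        rintro ⟨rfl, rfl⟩
        omega
  · rintro (⟨rfl, rfl⟩ | ⟨rfl, rfl⟩ | ⟨hne, ha, hb, hab, hc⟩)
    · refine ⟨by simp [hp], by simp, hpr, fun s hs => ?_⟩
      rcases Finset.mem_insert.1 hs with rfl | hs
      · omega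
      · have := hle s hs
        omega
    · refine ⟨by simp, by simp [hq], hrq, fun s hs => ?_⟩
      rcases Finset.mem_insert.1 hs with rfl | hs
      · omega
      · have := hle s hs
        omega
    · refine ⟨by simp [ha], by simp [hb], hab, fun s hs => ?_⟩
      rcases Finset.mem_insert.1 hs with rfl | hs
      · have h1 := hle a ha
        have h2 := hle b hb
        have h3 := hc p hp
        have h4 := hc q hq
        omega
      · exact hc s hs

theorem pathSum_insert (h : ℕ → ℕ → ℝ) {S : Finset ℕ} {p r q : ℕ} (hS : Consecutive S p q)
    (hpr : p < r) (hrq : r < q) :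
    pathSum h (insert r S) = pathSum h S + (h p r + h r q - h p q) := by
  have hr : r ∉ S := fun hr => hS.2.2.2 r hr hpr hrq
  have hmem : (p, q) ∈ consecutivePairs S := mem_consecutivePairs.2 hS
  have e : consecutivePairs (insert r S) =
      insert (p, r) (insert (r, q) ((consecutivePairs S).erase (p, q))) := by
    ext ⟨a, b⟩
    simp only [mem_consecutivePairs, Finset.mem_insert, Finset.mem_erase, Prod.mk.injEq, ne_eq]
    exact consecutive_insert_iff hS hpr hrq a b
  unfold pathSum
  rw [e, Finset.sum_insert, Finset.sum_insert, ← Finset.add_sum_erase _ _ hmem]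
  · ring
  · simp only [Finset.mem_erase, mem_consecutivePairs, not_and]
    exact fun _ hc => hr hc.1
  · simp only [Finset.mem_insert, Finset.mem_erase, mem_consecutivePairs, Prod.mk.injEq]
    rintro (⟨hc, -⟩ | ⟨-, hc⟩)
    · omega
    · exact hr hc.2.1

theorem exists_consecutive {S : Finset ℕ} {r a b : ℕ} (hr : r ∉ S) (ha : a ∈ S) (har : a < r)
    (hb : b ∈ S) (hrb : r < b) : ∃ p q, Consecutive S p q ∧ p < r ∧ r < q ∧ a ≤ p ∧ q ≤ b := by
  have h1 : (S.filter (· < r)).Nonempty := ⟨a, by simp [ha, har]⟩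
  have h2 : (S.filter (r < ·)).Nonempty := ⟨b, by simp [hb, hrb]⟩
  have hp := Finset.mem_filter.1 (Finset.max'_mem _ h1)
  have hq := Finset.mem_filter.1 (Finset.min'_mem _ h2)
  refine ⟨_, _, ⟨hp.1, hq.1, hp.2.trans hq.2, fun s hs h3 h4 => ?_⟩, hp.2, hq.2,
    Finset.le_max' _ _ (by simp [ha, har]), Finset.min'_le _ _ (by simp [hb, hrb])⟩
  rcases lt_trichotomy s r with h5 | rfl | h5
  · have := Finset.le_max' (S.filter (· < r)) s (by simp [hs, h5])
    omega
  · exact hr hs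
  · have := Finset.min'_le (S.filter (r < ·)) s (by simp [hs, h5])
    omega

/-- Path sums of cocycles up to a function of the intermediate point. -/
theorem pathSum_of_cocycle (h : ℕ → ℕ → ℝ) (g : ℕ → ℝ) (N : ℕ) (hN : 0 < N)
    (hc : ∀ p r q, p < r → r < q → q ≤ N → h p r + h r q - h p q = g r) (T : Finset ℕ)
    (hT : ∀ r ∈ T, 0 < r ∧ r < N) :
    pathSum h (insert 0 (insert N T)) = h 0 N + ∑ r ∈ T, g r := by
  induction T using Finset.induction_on with
  | empty =>
    have : consecutivePairs (insert 0 (insert N ∅)) = {(0, N)} := by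
      ext ⟨a, b⟩
      simp only [mem_consecutivePairs, Finset.mem_singleton, Prod.mk.injEq]
      constructor
      · rintro ⟨ha, hb, hab, -⟩
        simp only [Finset.mem_insert, Finset.notMem_empty, or_false] at ha hb
        omega
      · rintro ⟨rfl, rfl⟩
        refine ⟨by simp, by simp, hN, fun s hs => ?_⟩
        simp only [Finset.mem_insert, Finset.notMem_empty, or_false] at hs
        omega
    rw [pathSum, this]
    simp
  | insert r T hr ih =>
    have hrN := hT r (by simp)
    have hrS : r ∉ insert 0 (insert N T) := by
      simp only [Finset.mem_insert, not_or]
      exact ⟨by omega, by omega, hr⟩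
    obtain ⟨p, q, hpq, hpr, hrq, -, hqN⟩ :=
      exists_consecutive hrS (a := 0) (by simp) hrN.1 (b := N) (by simp) hrN.2
    rw [Finset.insert_comm N r T, Finset.insert_comm 0 r, pathSum_insert h hpq hpr hrq,
      ih fun s hs => hT s (by simp [hs]), hc p r q hpr hrq hqN, Finset.sum_insert hr]
    ring

/-- The mixed second difference of a path sum. -/
theorem pathSum_mixed_difference (h : ℕ → ℕ → ℝ) {S : Finset ℕ} {N i j : ℕ} (h0 : 0 ∈ S)
    (hN : N ∈ S) (hi0 : 0 < i) (hij : i < j) (hjN : j < N) (hi : i ∉ S) (hj : j ∉ S) :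
    (pathSum h (insert i (insert j S)) + pathSum h S -
      pathSum h (insert i S) - pathSum h (insert j S) = 0) ∨
    ∃ p q, p < i ∧ j < q ∧ q ≤ N ∧
      pathSum h (insert i (insert j S)) + pathSum h S -
        pathSum h (insert i S) - pathSum h (insert j S) = h i j + h p q - h i q - h p j := by
  obtain ⟨p, q, hpq, hpi, hiq, -, hqN⟩ := exists_consecutive hi h0 hi0 hN (by omega)
  rw [pathSum_insert h hpq hpi hiq]
  obtain ⟨hp, hq, hlt, hn⟩ := hpq
  -- If a label of `S` separates `i` from `j`, the two insertions affect different edges of the path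
  -- and the difference vanishes. Otherwise both subdivide the same edge `(p, q)`.
  by_cases hqj : q < j
  · have : Consecutive (insert j S) p q :=
      ⟨by simp [hp], by simp [hq], hlt, fun s hs => by
        rcases Finset.mem_insert.1 hs with rfl | hs
        · omega
        · exact hn s hs⟩
    left
    rw [pathSum_insert h this hpi hiq]
    ring
  · have hne : q ≠ j := fun e => hj (e ▸ hq)
    have : Consecutive (insert j S) p j :=
      ⟨by simp [hp], by simp, by omega, fun s hs => by
        rcases Finset.mem_insert.1 hs with rfl | hs
        · omega
        · have := hn s hs
          omega⟩
    right
    refine ⟨p, q, hpi, by omega, hqN, ?_⟩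
    rw [pathSum_insert h this hpi hij]
    ring

/-! ### The sets `R_δ` -/

namespace UpDownPartition

variable {n : ℕ} (c : UpDownPartition n)

theorem zero_notMem_up : 0 ∉ c.up := fun h => by
  have := c.up_bounds _ h
  omega

theorem succ_notMem_up : n + 1 ∉ c.up := fun h => by
  have := c.up_bounds _ h
  omega

theorem mem_downBar {x : ℕ} : x ∈ c.downBar ↔ x ≤ n + 1 ∧ x ∉ c.up := by
  simp only [downBar, Finset.mem_sdiff, Finset.mem_range]
  exact and_congr_left fun _ => by omega

theorem pos_lt_card_of_down {x : ℕ} (hx : x ≤ n + 1) (h : x ∉ c.up) :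
    c.pos x < c.downBar.card := by
  rw [pos, if_neg h]
  refine Finset.card_lt_card ⟨Finset.filter_subset _ _, fun hs => ?_⟩
  have := hs (c.mem_downBar.2 ⟨hx, h⟩)
  simp at this

theorem card_le_pos_of_up {x : ℕ} (h : x ∈ c.up) : c.downBar.card ≤ c.pos x := by
  rw [pos, if_pos h]
  exact Nat.le_add_right _ _

theorem pos_lt_pos_of_down {x y : ℕ} (hx : x ∉ c.up) (hy : y ∉ c.up) (hyn : y ≤ n + 1)
    (h : x < y) : c.pos x < c.pos y := by
  rw [pos, pos, if_neg hx, if_neg hy]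
  refine Finset.card_lt_card ⟨fun d hd => ?_, fun hs => ?_⟩
  · rw [Finset.mem_filter] at hd ⊢
    exact ⟨hd.1, hd.2.trans h⟩
  · have := hs (Finset.mem_filter.2 ⟨c.mem_downBar.2 ⟨by omega, hx⟩, h⟩)
    simp at this

theorem pos_lt_pos_of_up {x y : ℕ} (hx : x ∈ c.up) (hy : y ∈ c.up)
    (h : x < y) : c.pos y < c.pos x := by
  rw [pos, pos, if_pos hx, if_pos hy]
  refine Nat.add_lt_add_left (Finset.card_lt_card ⟨fun d hd => ?_, fun hs => ?_⟩) _
  · rw [Finset.mem_filter] at hd ⊢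
    exact ⟨hd.1, h.trans hd.2⟩
  · have := hs (Finset.mem_filter.2 ⟨hy, h⟩)
    simp at this

theorem card_downBar_add_card_up : c.downBar.card + c.up.card = n + 2 := by
  have hsub : c.up ⊆ Finset.range (n + 2) := fun u hu => by
    have := c.up_bounds u hu
    rw [Finset.mem_range]
    omega
  rw [downBar, Finset.card_sdiff_of_subset hsub, Finset.card_range]
  have := Finset.card_le_card hsub
  rw [Finset.card_range] at this
  omega

theorem pos_lt {x : ℕ} (hx : x ≤ n + 1) : c.pos x < n + 2 := by
  have hc := c.card_downBar_add_card_up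
  by_cases h : x ∈ c.up
  · rw [pos, if_pos h]
    have : (c.up.filter fun u => x < u).card < c.up.card :=
      Finset.card_lt_card ⟨Finset.filter_subset _ _, fun hs => by simpa using hs h⟩
    omega
  · have := c.pos_lt_card_of_down hx h
    omega

/-- The counter-clockwise order of the vertices in terms of their labels. -/
theorem pos_lt_pos_iff {x y : ℕ} (hx : x ≤ n + 1) (hy : y ≤ n + 1) :
    c.pos x < c.pos y ↔
      (x ∉ c.up ∧ y ∉ c.up ∧ x < y) ∨ (x ∉ c.up ∧ y ∈ c.up) ∨
        (x ∈ c.up ∧ y ∈ c.up ∧ y < x) := by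
  by_cases hxu : x ∈ c.up <;> by_cases hyu : y ∈ c.up <;>
    simp only [hxu, hyu, not_true_eq_false, not_false_eq_true, true_and, false_and, or_false,
      false_or, iff_true, iff_false, or_self]
  · constructor
    · intro h
      rcases lt_trichotomy x y with h1 | rfl | h1
      · have := c.pos_lt_pos_of_up hxu hyu h1
        omega
      · omega
      · exact h1
    · exact c.pos_lt_pos_of_up hyu hxu
  · have := c.card_le_pos_of_up hxu
    have := c.pos_lt_card_of_down hy hyu
    omega
  · have := c.card_le_pos_of_up hyu
    have := c.pos_lt_card_of_down hx hxu
    omega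
  · constructor
    · intro h
      rcases lt_trichotomy x y with h1 | rfl | h1
      · exact h1
      · omega
      · have := c.pos_lt_pos_of_down hyu hxu hx h1
        omega
    · exact c.pos_lt_pos_of_down hxu hyu hy

theorem lab_pos (i : Fin n) : 0 < lab i := Nat.succ_pos _

theorem lab_le (i : Fin n) : lab i ≤ n := i.isLt

theorem lab_injective : Function.Injective (lab : Fin n → ℕ) := fun i j h => by
  simp only [lab] at h
  exact Fin.ext (by omega)

theorem lab_lt_lab {i j : Fin n} : lab i < lab j ↔ i < j :=
  Nat.succ_lt_succ_iff

theorem lab_le_lab {i j : Fin n} : lab i ≤ lab j ↔ i ≤ j :=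
  Nat.succ_le_succ_iff

theorem isAdjacent_iff {p q : ℕ} (hp : p ≤ n + 1) (hq : q ≤ n + 1) :
    c.IsAdjacent p q ↔ c.pos p + 1 = c.pos q ∨ c.pos q + 1 = c.pos p ∨
      (c.pos p = n + 1 ∧ c.pos q = 0) ∨ (c.pos q = n + 1 ∧ c.pos p = 0) := by
  have h1 := c.pos_lt hp
  have h2 := c.pos_lt hq
  have key : ∀ a b : ℕ, a < n + 2 → b < n + 2 →
      ((a + 1) % (n + 2) = b ↔ a + 1 = b ∨ (a = n + 1 ∧ b = 0)) := by
    intro a b ha hb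
    rcases Nat.lt_or_ge (a + 1) (n + 2) with h | h
    · rw [Nat.mod_eq_of_lt h]
      omega
    · have : a = n + 1 := by omega
      subst this
      rw [Nat.mod_self]
      omega
  rw [IsAdjacent, key _ _ h1 h2, key _ _ h2 h1]
  tauto

theorem pos_eq_of_up_eq_empty (h : c.up = ∅) {x : ℕ} (hx : x ≤ n + 1) : c.pos x = x := by
  have : (c.downBar.filter fun d => d < x) = Finset.range x := by
    ext d
    simp only [Finset.mem_filter, mem_downBar, Finset.mem_range, h, Finset.notMem_empty,
      not_false_eq_true, and_true]
    omega
  rw [pos, if_neg (by simp [h]), this, Finset.card_range]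

/-- This trades cyclic positions for inequalities between labels. The weak inequalities for up
labels reflect the replacement rule: when `p` is up, `0` lies to the right of the diagonal and is
replaced by `p`, and similarly for `n + 1` and `q`. -/
theorem mem_R_of_isProperDiagonal {p q : ℕ} (h : c.IsProperDiagonal p q) (i : Fin n) :
    i ∈ c.R p q ↔
      (lab i ∉ c.up ∧ (p ∈ c.up ∨ p < lab i) ∧ (q ∈ c.up ∨ lab i < q)) ∨
      (lab i ∈ c.up ∧ ((p ∈ c.up ∧ lab i ≤ p) ∨ (q ∈ c.up ∧ q ≤ lab i))) := by
  rw [R, if_pos h, Finset.mem_filter]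
  obtain ⟨hpq, hq, -⟩ := h
  have hi : lab i ≤ n + 1 := (lab_le i).trans (Nat.le_succ n)
  have hi0 := lab_pos i
  have hin := lab_le i
  have h0 := c.zero_notMem_up
  have h1 := c.succ_notMem_up
  simp only [Finset.mem_univ, true_and, IsRightOf]
  rw [c.pos_lt_pos_iff (x := p) (y := lab i) (by omega) hi,
    c.pos_lt_pos_iff (x := lab i) (y := q) hi hq,
    c.pos_lt_pos_iff (x := q) (y := p) hq (by omega),
    c.pos_lt_pos_iff (x := p) (y := 0) (by omega) (by omega),
    c.pos_lt_pos_iff (x := 0) (y := q) (by omega) hq,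
    c.pos_lt_pos_iff (x := p) (y := n + 1) (by omega) le_rfl,
    c.pos_lt_pos_iff (x := n + 1) (y := q) le_rfl hq]
  have e1 : lab i = p → (lab i ∈ c.up ↔ p ∈ c.up) := fun h => by rw [h]
  have e2 : lab i = q → (lab i ∈ c.up ↔ q ∈ c.up) := fun h => by rw [h]
  by_cases hpu : p ∈ c.up <;> by_cases hqu : q ∈ c.up <;> by_cases hiu : lab i ∈ c.up <;>
    simp only [hpu, hqu, hiu, h0, h1, not_true_eq_false, not_false_eq_true, true_and, and_true,
      false_and, and_false, or_false, false_or, or_true, true_or, iff_true,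
      iff_false, imp_false] at e1 e2 ⊢ <;> omega

theorem R_eq_of_not_isProperDiagonal {p q : ℕ} (h : ¬ c.IsProperDiagonal p q) :
    c.R p q = if p = 0 ∧ q = n + 1 ∧ c.up = ∅ then Finset.univ
      else if p ∉ c.up ∧ q ∉ c.up then ∅ else Finset.univ := by
  rw [R, if_neg h]

/-- The conventions for edges and degenerate diagonals agree with the description of `R_δ` for
proper diagonals. -/
theorem mem_R {p q : ℕ} (hn : 1 ≤ n) (hpq : p ≤ q) (hq : q ≤ n + 1) (i : Fin n) :
    i ∈ c.R p q ↔
      (lab i ∉ c.up ∧ (p ∈ c.up ∨ p < lab i) ∧ (q ∈ c.up ∨ lab i < q)) ∨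
      (lab i ∈ c.up ∧ ((p ∈ c.up ∧ lab i ≤ p) ∨ (q ∈ c.up ∧ q ≤ lab i))) := by
  by_cases h : c.IsProperDiagonal p q
  · exact c.mem_R_of_isProperDiagonal h i
  have hi : lab i ≤ n + 1 := (lab_le i).trans (Nat.le_succ n)
  have hi0 := lab_pos i
  have hin := lab_le i
  have h0 := c.zero_notMem_up
  have h1 := c.succ_notMem_up
  rw [c.R_eq_of_not_isProperDiagonal h]
  by_cases hs : p = 0 ∧ q = n + 1 ∧ c.up = ∅
  · obtain ⟨rfl, rfl, hu⟩ := hs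
    simp [hu]
    omega
  rw [if_neg hs]
  rcases hpq.eq_or_lt with rfl | hlt
  · by_cases hpu : p ∈ c.up <;> by_cases hiu : lab i ∈ c.up <;> simp [hpu, hiu] <;> omega
  have hadj : c.IsAdjacent p q := by
    by_contra hcon
    exact h ⟨hlt, hq, hcon⟩
  rw [c.isAdjacent_iff (by omega) hq] at hadj
  have hle : ∀ x : ℕ, x ≤ n + 1 → ∀ y : ℕ, y ≤ n + 1 → c.pos x = c.pos y → x = y := by
    intro x hx y hy hxy
    have a1 := c.pos_lt_pos_iff hx hy
    have a2 := c.pos_lt_pos_iff hy hx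
    rw [hxy] at a1 a2
    simp only [lt_irrefl, false_iff] at a1 a2
    by_cases hxu : x ∈ c.up <;> by_cases hyu : y ∈ c.up <;> simp [hxu, hyu] at a1 a2 <;> omega
  have h00 : c.pos 0 = 0 := by
    rw [pos, if_neg h0]
    simp
  have hpi := c.pos_lt_pos_iff (x := p) (y := lab i) (by omega) hi
  have hip := c.pos_lt_pos_iff (x := lab i) (y := p) hi (by omega)
  have hqi := c.pos_lt_pos_iff (x := q) (y := lab i) hq hi
  have hiq := c.pos_lt_pos_iff (x := lab i) (y := q) hi hq
  have hpN := c.pos_lt_pos_iff (x := p) (y := n + 1) (by omega) le_rfl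
  have hqN := c.pos_lt_pos_iff (x := q) (y := n + 1) hq le_rfl
  have hNp := c.pos_lt_pos_iff (x := n + 1) (y := p) le_rfl (by omega)
  have hNq := c.pos_lt_pos_iff (x := n + 1) (y := q) le_rfl hq
  have hpq' := c.pos_lt_pos_iff (x := p) (y := q) (by omega) hq
  have hqp' := c.pos_lt_pos_iff (x := q) (y := p) hq (by omega)
  have hlti := c.pos_lt hi
  have hp0 := hle p (by omega) 0 (by omega)
  have hq0 := hle q hq 0 (by omega)
  have hpi' := hle p (by omega) (lab i) hi
  have hqi' := hle q hq (lab i) hi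
  rw [h00] at hp0 hq0
  have e1 : lab i = p → (lab i ∈ c.up ↔ p ∈ c.up) := fun h => by rw [h]
  have e2 : lab i = q → (lab i ∈ c.up ↔ q ∈ c.up) := fun h => by rw [h]
  have hltN := c.pos_lt (x := n + 1) le_rfl
  -- The last and the first position are both held by down labels only if the up set is empty; the
  -- edge is then `{0, n + 1}`, already handled as the exceptional convention.
  have huN : p ∉ c.up → q ∉ c.up → c.pos q = n + 1 → c.pos p = 0 → False := by
    intro hpu hqu hq1 hp1
    have hcard := c.card_downBar_add_card_up
    have := c.pos_lt_card_of_down hq hqu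
    have hu : c.up = ∅ := Finset.card_eq_zero.1 (by omega)
    rw [c.pos_eq_of_up_eq_empty hu hq] at hq1
    exact hs ⟨hp0 hp1, hq1, hu⟩
  by_cases hpu : p ∈ c.up <;> by_cases hqu : q ∈ c.up <;> by_cases hiu : lab i ∈ c.up <;>
    simp only [hpu, hqu, hiu, h1, not_true_eq_false, not_false_eq_true, true_and, and_true,
      false_and, and_false, or_false, false_or, or_true, true_or, iff_true, true_iff, false_iff,
      iff_false, imp_false, if_true, if_false, Finset.mem_univ, Finset.notMem_empty, and_self,
      or_self, forall_const]
      at e1 e2 hpi hip hqi hiq hpN hqN hNp hNq hpq' hqp' huN ⊢ <;> omega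

/-! ### Tight values as path sums -/

/-- The path of labels encoding `I`: the extended down set with the down elements of `I` removed
and the up elements of `I` added. -/
noncomputable def pathSet (I : Finset (Fin n)) : Finset ℕ :=
  open Classical in (Finset.range (n + 2)).filter fun r => (r ∈ c.up ↔ ∃ i ∈ I, lab i = r)

/-- The contribution of two consecutive labels of the path to the tight value. -/
noncomputable def edgeWeight (w : Finset (Fin n) → ℝ) (p q : ℕ) : ℝ :=
  w (c.R p q) - w Finset.univ / 2 * ((if p ∈ c.up then 1 else 0) + if q ∈ c.up then 1 else 0)

/-- The tight values of the associahedron. -/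
noncomputable def tightValue (w : Finset (Fin n) → ℝ) (I : Finset (Fin n)) : ℝ :=
  pathSum (c.edgeWeight w) (c.pathSet I)

theorem mem_pathSet {I : Finset (Fin n)} {r : ℕ} :
    r ∈ c.pathSet I ↔ r ≤ n + 1 ∧ (r ∈ c.up ↔ ∃ i ∈ I, lab i = r) := by
  simp only [pathSet, Finset.mem_filter, Finset.mem_range]
  exact and_congr_left fun _ => by omega

theorem zero_mem_pathSet (I : Finset (Fin n)) : 0 ∈ c.pathSet I := by
  refine c.mem_pathSet.2 ⟨by omega, iff_of_false c.zero_notMem_up ?_⟩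
  rintro ⟨i, -, h⟩
  have := lab_pos i
  omega

theorem succ_mem_pathSet (I : Finset (Fin n)) : n + 1 ∈ c.pathSet I := by
  refine c.mem_pathSet.2 ⟨le_rfl, iff_of_false c.succ_notMem_up ?_⟩
  rintro ⟨i, -, h⟩
  have := lab_le i
  omega

theorem exists_lab_eq {I : Finset (Fin n)} {j : Fin n} : (∃ i ∈ I, lab i = lab j) ↔ j ∈ I :=
  ⟨fun ⟨_, hi, h⟩ => lab_injective h ▸ hi, fun h => ⟨j, h, rfl⟩⟩

theorem lab_mem_pathSet {I : Finset (Fin n)} {j : Fin n} :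
    lab j ∈ c.pathSet I ↔ (lab j ∈ c.up ↔ j ∈ I) := by
  rw [mem_pathSet, exists_lab_eq]
  have := lab_le j
  exact and_iff_right (by omega)

theorem exists_lab {r : ℕ} (h0 : r ≠ 0) (hr : r ≤ n) : ∃ i : Fin n, lab i = r :=
  ⟨⟨r - 1, by omega⟩, by simp only [lab]; omega⟩

theorem pathSet_ext {S : Finset ℕ} {I : Finset (Fin n)} (h0 : 0 ∈ S) (hN : n + 1 ∈ S)
    (hS : ∀ r ∈ S, r ≤ n + 1) (h : ∀ i, lab i ∈ S ↔ (lab i ∈ c.up ↔ i ∈ I)) :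
    c.pathSet I = S := by
  ext r
  by_cases hr : r ≤ n + 1
  · rcases Nat.eq_zero_or_pos r with rfl | hr0
    · exact iff_of_true (c.zero_mem_pathSet I) h0
    · rcases hr.eq_or_lt with rfl | hlt
      · exact iff_of_true (c.succ_mem_pathSet I) hN
      · obtain ⟨i, rfl⟩ := exists_lab (n := n) (r := r) (by omega) (by omega)
        rw [h, lab_mem_pathSet]
  · exact iff_of_false (fun hh => hr (c.mem_pathSet.1 hh).1) fun hh => hr (hS r hh)

theorem pathSet_insert_of_up {I : Finset (Fin n)} {i : Fin n} (hi : lab i ∈ c.up) :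
    c.pathSet (insert i I) = insert (lab i) (c.pathSet I) := by
  refine c.pathSet_ext (by simp [zero_mem_pathSet]) (by simp [succ_mem_pathSet]) ?_ ?_
  · intro r hr
    rcases Finset.mem_insert.1 hr with rfl | hr
    · exact (lab_le i).trans (Nat.le_succ n)
    · exact (c.mem_pathSet.1 hr).1
  · intro j
    rw [Finset.mem_insert, Finset.mem_insert, lab_mem_pathSet, lab_injective.eq_iff]
    by_cases hji : j = i
    · subst hji; simp [hi]
    · simp [hji]

theorem pathSet_of_down {I : Finset (Fin n)} {i : Fin n} (hi : lab i ∉ c.up) (hiI : i ∉ I) :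
    c.pathSet I = insert (lab i) (c.pathSet (insert i I)) := by
  refine c.pathSet_ext (by simp [zero_mem_pathSet]) (by simp [succ_mem_pathSet]) ?_ ?_
  · intro r hr
    rcases Finset.mem_insert.1 hr with rfl | hr
    · exact (lab_le i).trans (Nat.le_succ n)
    · exact (c.mem_pathSet.1 hr).1
  · intro j
    rw [Finset.mem_insert, lab_mem_pathSet, Finset.mem_insert, lab_injective.eq_iff]
    by_cases hji : j = i
    · subst hji; simp [hi, hiI]
    · simp [hji]

/-- For indicator vectors, `R_{pr} + R_{rq} - R_{pq}` is `-e_r` if `r` is down and `[n] + e_r` if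
`r` is up. The two half corrections at `r` remove the extra `[n]`. -/
theorem edgeWeight_modular_cocycle (hn : 1 ≤ n) (x : Fin n → ℝ) {p r q : ℕ} (hpr : p < r)
    (hrq : r < q) (hq : q ≤ n + 1) :
    c.edgeWeight (fun I => ∑ i ∈ I, x i) p r + c.edgeWeight (fun I => ∑ i ∈ I, x i) r q -
      c.edgeWeight (fun I => ∑ i ∈ I, x i) p q =
      ∑ i, if lab i = r then (if r ∈ c.up then x i else -x i) else 0 := by
  have hR : ∀ I : Finset (Fin n), ∑ i ∈ I, x i = ∑ i, if i ∈ I then x i else 0 := by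
    intro I
    rw [Finset.sum_ite_mem, Finset.univ_inter]
  have key : ∀ i, (if i ∈ c.R p r then x i else 0) + (if i ∈ c.R r q then x i else 0) -
      (if i ∈ c.R p q then x i else 0) - (if r ∈ c.up then x i else 0) =
      if lab i = r then (if r ∈ c.up then x i else -x i) else 0 := by
    intro i
    have m1 := c.mem_R hn hpr.le (by omega) i
    have m2 := c.mem_R hn hrq.le hq i
    have m3 := c.mem_R hn (hpr.trans hrq).le hq i
    rcases eq_or_ne (lab i) r with rfl | hir
    · have a1 : i ∈ c.R p (lab i) ↔ lab i ∈ c.up := by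
        rw [m1]
        by_cases h : lab i ∈ c.up <;> simp [h]
      have a2 : i ∈ c.R (lab i) q ↔ lab i ∈ c.up := by
        rw [m2]
        by_cases h : lab i ∈ c.up <;> simp [h]
      have a3 : i ∈ c.R p q ↔ lab i ∉ c.up := by
        rw [m3]
        by_cases h : lab i ∈ c.up
        · simp only [h, not_true_eq_false, false_and, true_and, false_or, iff_false]
          omega
        · simp only [h, not_false_eq_true, true_and, false_and, or_false, iff_true]
          exact ⟨Or.inr hpr, Or.inr hrq⟩
      rw [if_pos rfl]
      by_cases h : lab i ∈ c.up <;> simp [a1, a2, a3, h]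
    · rw [if_neg hir]
      by_cases hru : r ∈ c.up
      · have hor : i ∈ c.R p r ∨ i ∈ c.R r q := by
          rw [m1, m2]
          by_cases h : lab i ∈ c.up <;> by_cases hpu : p ∈ c.up <;> by_cases hqu : q ∈ c.up <;>
            simp [h, hru, hpu, hqu] <;> omega
        have hand : i ∈ c.R p q ↔ i ∈ c.R p r ∧ i ∈ c.R r q := by
          rw [m1, m2, m3]
          by_cases h : lab i ∈ c.up <;> by_cases hpu : p ∈ c.up <;> by_cases hqu : q ∈ c.up <;>
            simp [h, hru, hpu, hqu] <;> omega
        by_cases h1 : i ∈ c.R p r <;> by_cases h2 : i ∈ c.R r q <;>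
          simp_all
      · have hor : i ∈ c.R p q ↔ i ∈ c.R p r ∨ i ∈ c.R r q := by
          rw [m1, m2, m3]
          by_cases h : lab i ∈ c.up <;> by_cases hpu : p ∈ c.up <;> by_cases hqu : q ∈ c.up <;>
            simp [h, hru, hpu, hqu] <;> omega
        have hand : ¬ (i ∈ c.R p r ∧ i ∈ c.R r q) := by
          rw [m1, m2]
          by_cases h : lab i ∈ c.up <;> by_cases hpu : p ∈ c.up <;> by_cases hqu : q ∈ c.up <;>
            simp [h, hru, hpu, hqu] <;> omega
        by_cases h1 : i ∈ c.R p r <;> by_cases h2 : i ∈ c.R r q <;>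
          simp_all
  have hU : (∑ i, x i) * (if r ∈ c.up then 1 else 0) = ∑ i, if r ∈ c.up then x i else 0 := by
    split_ifs <;> simp
  rw [← Finset.sum_congr rfl fun i _ => key i, Finset.sum_sub_distrib, Finset.sum_sub_distrib,
    Finset.sum_add_distrib, ← hR, ← hR, ← hR, ← hU]
  simp only [edgeWeight]
  ring

theorem tightValue_modular (hn : 1 ≤ n) (x : Fin n → ℝ) (I : Finset (Fin n)) :
    c.tightValue (fun I => ∑ i ∈ I, x i) I = ∑ i ∈ I, x i := by
  set T := (c.pathSet I).filter fun r => 0 < r ∧ r < n + 1 with hT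
  have hS : c.pathSet I = insert 0 (insert (n + 1) T) := by
    ext r
    have := c.zero_mem_pathSet I
    have := c.succ_mem_pathSet I
    simp only [hT, Finset.mem_insert, Finset.mem_filter]
    constructor
    · intro hr
      have := (c.mem_pathSet.1 hr).1
      by_cases h1 : r = 0
      · exact Or.inl h1
      · by_cases h2 : r = n + 1
        · exact Or.inr (Or.inl h2)
        · exact Or.inr (Or.inr ⟨hr, by omega, by omega⟩)
    · rintro (rfl | rfl | hr)
      · assumption
      · assumption
      · exact hr.1
  -- The edge `(0, n + 1)` contributes the down set. Each down label on the path, hence outside `I`,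
  -- is then subtracted, and each up label of `I` is added; `I` remains.
  rw [tightValue, hS, pathSum_of_cocycle _
    (fun r => ∑ i, if lab i = r then (if r ∈ c.up then x i else -x i) else 0) (n + 1) (by omega)
    (fun p r q hpr hrq hq => c.edgeWeight_modular_cocycle hn x hpr hrq hq) T
    (fun r hr => (Finset.mem_filter.1 hr).2), Finset.sum_comm, edgeWeight,
    if_neg c.zero_notMem_up, if_neg c.succ_notMem_up]
  have hR : ∀ I : Finset (Fin n), ∑ i ∈ I, x i = ∑ i, if i ∈ I then x i else 0 := by
    intro I
    rw [Finset.sum_ite_mem, Finset.univ_inter]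
  simp only [add_zero, mul_zero, sub_zero]
  rw [hR (c.R 0 (n + 1)), hR I, ← Finset.sum_add_distrib]
  refine Finset.sum_congr rfl fun i _ => ?_
  rw [Finset.sum_ite_eq T (lab i) fun r => if r ∈ c.up then x i else -x i]
  have hiT : lab i ∈ T ↔ (lab i ∈ c.up ↔ i ∈ I) := by
    rw [hT, Finset.mem_filter, lab_mem_pathSet]
    have := lab_le i
    exact and_iff_left ⟨lab_pos i, by omega⟩
  have hiR : i ∈ c.R 0 (n + 1) ↔ lab i ∉ c.up := by
    rw [c.mem_R hn (by omega) le_rfl]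
    have := lab_le i
    have := lab_pos i
    simp only [c.zero_notMem_up, c.succ_notMem_up]
    by_cases h : lab i ∈ c.up
    · simp [h]
    · simp [h]
      omega
  rw [if_congr hiT rfl rfl, if_congr hiR rfl rfl]
  by_cases h1 : lab i ∈ c.up <;> by_cases h2 : i ∈ I <;> simp [h1, h2]

theorem R_eq_empty_or_univ {p q : ℕ} (h : ¬ c.IsProperDiagonal p q) :
    c.R p q = ∅ ∨ c.R p q = Finset.univ := by
  rw [c.R_eq_of_not_isProperDiagonal h]
  split_ifs <;> simp

theorem le_of_mem_associahedron {w : Finset (Fin n) → ℝ} (h0 : w ∅ = 0) {x : Fin n → ℝ}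
    (hx : x ∈ c.associahedron w) (p q : ℕ) : w (c.R p q) ≤ ∑ i ∈ c.R p q, x i := by
  by_cases h : c.IsProperDiagonal p q
  · exact hx.2 p q h
  · rcases c.R_eq_empty_or_univ h with e | e
    · simp [e, h0]
    · rw [e, hx.1]

/-- Compare the path sum of `w` edge by edge with that of the additive function of `x`. The
corrections agree because `x` has total `w_[n]`. -/
theorem tightValue_le (hn : 1 ≤ n) {w : Finset (Fin n) → ℝ} (h0 : w ∅ = 0) {x : Fin n → ℝ}
    (hx : x ∈ c.associahedron w) (I : Finset (Fin n)) :
    c.tightValue w I ≤ ∑ i ∈ I, x i := by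
  rw [← c.tightValue_modular hn x I]
  refine Finset.sum_le_sum fun e _ => ?_
  have := c.le_of_mem_associahedron h0 hx e.1 e.2
  simp only [edgeWeight, hx.1]
  linarith

/-- If all pairs of consecutive labels of the path of `I` but at most one are edges of the polygon,
and the remaining one has `R_δ = I`, then the tight value is the original one. -/
theorem tightValue_eq_of_consecutive (hn : 1 ≤ n) {w : Finset (Fin n) → ℝ} (h0 : w ∅ = 0)
    {I : Finset (Fin n)} {a b : ℕ} (hab : Consecutive (c.pathSet I) a b) (hI : c.R a b = I)
    (h : ∀ p q, Consecutive (c.pathSet I) p q → (p, q) ≠ (a, b) →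
      c.R p q = ∅ ∨ c.R p q = Finset.univ) :
    c.tightValue w I = w I := by
  -- Any vector of total `w_[n]` would do: its additive function agrees with `w` on `∅` and `[n]`,
  -- so the two path sums differ only at `(a, b)`.
  set x : Fin n → ℝ := fun i => if i = ⟨0, hn⟩ then w Finset.univ else 0 with hx
  have hsum : ∑ i, x i = w Finset.univ := by simp [hx]
  have hmod := c.tightValue_modular hn x I
  have hdiff : c.tightValue w I - c.tightValue (fun I => ∑ i ∈ I, x i) I =
      w I - ∑ i ∈ I, x i := by
    rw [tightValue, tightValue, pathSum, pathSum, ← Finset.sum_sub_distrib,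
      Finset.sum_eq_single_of_mem (a, b) (mem_consecutivePairs.2 hab)]
    · simp only [edgeWeight, hsum, hI]
      ring
    · intro e he hne
      have := h e.1 e.2 (mem_consecutivePairs.1 he) hne
      simp only [edgeWeight, hsum]
      rcases this with e | e <;> simp [e, h0, hsum]
  linarith

theorem one_notMem_up : 1 ∉ c.up := fun h => by
  have := c.up_bounds _ h
  omega

/-- The path of `R_δ` follows the boundary of the polygon from `0` to `a` on the side of `a`,
crosses along `δ`, and follows the boundary from `b` to `n + 1` on the side of `b`. -/
theorem mem_pathSet_R (hn : 1 ≤ n) {a b r : ℕ} (hab : a < b) (hb : b ≤ n + 1) :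
    r ∈ c.pathSet (c.R a b) ↔ r = 0 ∨ r = n + 1 ∨
      (r ≤ n + 1 ∧ (((r ∈ c.up ↔ a ∈ c.up) ∧ r ≤ a) ∨ ((r ∈ c.up ↔ b ∈ c.up) ∧ b ≤ r))) := by
  by_cases h0 : r = 0
  · subst h0
    simp [zero_mem_pathSet]
  by_cases h1 : r = n + 1
  · subst h1
    simp [succ_mem_pathSet]
  by_cases h2 : r ≤ n
  · obtain ⟨i, rfl⟩ := exists_lab h0 h2
    rw [lab_mem_pathSet, c.mem_R hn hab.le hb]
    by_cases hi : lab i ∈ c.up <;> by_cases ha : a ∈ c.up <;> by_cases hb : b ∈ c.up <;>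
      simp only [hi, ha, hb, not_true_eq_false, not_false_eq_true, true_and, false_and, or_false,
        false_or, true_or, iff_true, true_iff, iff_false, false_iff, and_false, and_true, or_self,
        true_or] <;> omega
  · refine iff_of_false (fun h => h2 ?_) (by omega)
    have := (c.mem_pathSet.1 h).1
    omega

theorem tightValue_R_of_lt (hn : 1 ≤ n) {w : Finset (Fin n) → ℝ} (h0 : w ∅ = 0) {a b : ℕ}
    (hab : a < b) (hb : b ≤ n + 1) : c.tightValue w (c.R a b) = w (c.R a b) := by
  have hz := c.zero_notMem_up
  have hs := c.succ_notMem_up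
  refine c.tightValue_eq_of_consecutive hn h0 (a := a) (b := b) ⟨?_, ?_, hab, ?_⟩ rfl ?_
  · rw [c.mem_pathSet_R hn hab hb]
    exact Or.inr (Or.inr ⟨by omega, Or.inl ⟨Iff.rfl, le_rfl⟩⟩)
  · rw [c.mem_pathSet_R hn hab hb]
    exact Or.inr (Or.inr ⟨hb, Or.inr ⟨Iff.rfl, le_rfl⟩⟩)
  · intro r hr
    rw [c.mem_pathSet_R hn hab hb] at hr
    omega
  · rintro p q ⟨hp, hq, hpq, hc⟩ hne
    have hca := hc a (by rw [c.mem_pathSet_R hn hab hb]; exact Or.inr (Or.inr ⟨by omega, by simp⟩))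
    have hcb := hc b (by rw [c.mem_pathSet_R hn hab hb]; exact Or.inr (Or.inr ⟨hb, by simp⟩))
    have hqn := (c.mem_pathSet.1 hq).1
    rw [c.mem_pathSet_R hn hab hb] at hp hq
    have hne' : ¬ (p = a ∧ q = b) := fun h => hne (by rw [h.1, h.2])
    have hci : ∀ i : Fin n, ((lab i ∈ c.up ↔ a ∈ c.up) ∧ lab i ≤ a) ∨
        ((lab i ∈ c.up ↔ b ∈ c.up) ∧ b ≤ lab i) → p < lab i → ¬ lab i < q := by
      intro i hi
      have := lab_le i
      exact hc _ (by rw [c.mem_pathSet_R hn hab hb]; exact Or.inr (Or.inr ⟨by omega, hi⟩))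
    have hp0 : p = 0 → p ∉ c.up := fun h => h ▸ hz
    have hqN : q = n + 1 → q ∉ c.up := fun h => h ▸ hs
    have hpa : p = a → (p ∈ c.up ↔ a ∈ c.up) := fun h => by rw [h]
    have hqb : q = b → (q ∈ c.up ↔ b ∈ c.up) := fun h => by rw [h]
    have hqa : q = a → (q ∈ c.up ↔ a ∈ c.up) := fun h => by rw [h]
    have hpb : p = b → (p ∈ c.up ↔ b ∈ c.up) := fun h => by rw [h]
    by_cases hu : p ∉ c.up ∧ q ∉ c.up
    · left
      obtain ⟨hpu, hqu⟩ := hu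
      refine Finset.eq_empty_of_forall_notMem fun i => ?_
      have hci := hci i
      have := lab_le i
      have := lab_pos i
      clear hc hne
      rw [c.mem_R hn hpq.le hqn]
      by_cases hi : lab i ∈ c.up <;> by_cases ha : a ∈ c.up <;> by_cases hbu : b ∈ c.up <;>
        simp only [hpu, hqu, hi, ha, hbu, iff_true, iff_false, not_true_eq_false,
          not_false_eq_true, true_and, false_and, and_false, or_false, false_or, imp_false,
          and_self]
          at hci hp hq hp0 hqN hpa hqb hqa hpb ⊢ <;> omega
    · right
      refine Finset.eq_univ_of_forall fun i => ?_
      have hci := hci i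
      have := lab_le i
      have := lab_pos i
      clear hc hne
      rw [c.mem_R hn hpq.le hqn]
      by_cases hi : lab i ∈ c.up <;> by_cases ha : a ∈ c.up <;> by_cases hbu : b ∈ c.up <;>
      by_cases hpu : p ∈ c.up <;> by_cases hqu : q ∈ c.up <;>
        simp only [hpu, hqu, hi, ha, hbu, iff_true, iff_false, not_true_eq_false,
          not_false_eq_true, true_and, false_and, and_true, and_false, or_false, false_or,
          imp_false, and_self, true_or]
          at hci hp hq hp0 hqN hpa hqb hqa hpb hu ⊢ <;> omega

theorem tightValue_empty (hn : 1 ≤ n) {w : Finset (Fin n) → ℝ} (h0 : w ∅ = 0) :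
    c.tightValue w ∅ = 0 := by
  have e : c.R 0 1 = ∅ := by
    refine Finset.eq_empty_of_forall_notMem fun i => ?_
    rw [c.mem_R hn (by omega) (by omega)]
    have := lab_pos i
    simp only [c.zero_notMem_up, c.one_notMem_up, false_and, or_self, and_false, false_or, or_false]
    omega
  have := c.tightValue_R_of_lt hn h0 (a := 0) (b := 1) (by omega) (by omega)
  rwa [e, h0] at this

/-- The full set is `R` of an edge at `n + 1`, whose other end is the largest up label, or `0` if
there are no up labels. -/
theorem tightValue_univ (hn : 1 ≤ n) {w : Finset (Fin n) → ℝ} (h0 : w ∅ = 0) :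
    c.tightValue w Finset.univ = w Finset.univ := by
  obtain ⟨a, ha, e⟩ : ∃ a < n + 1, c.R a (n + 1) = Finset.univ := by
    rcases c.up.eq_empty_or_nonempty with hu | hu
    · refine ⟨0, by omega, Finset.eq_univ_of_forall fun i => ?_⟩
      rw [c.mem_R hn (by omega) le_rfl]
      have := lab_pos i
      have := lab_le i
      simp [hu]
      omega
    · have hm := c.up.max'_mem hu
      have hb := c.up_bounds _ hm
      refine ⟨c.up.max' hu, by omega, Finset.eq_univ_of_forall fun i => ?_⟩
      rw [c.mem_R hn (by omega) le_rfl]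
      have := lab_le i
      by_cases hi : lab i ∈ c.up
      · exact Or.inr ⟨hi, Or.inl ⟨hm, Finset.le_max' _ _ hi⟩⟩
      · exact Or.inl ⟨hi, Or.inl hm, Or.inr (by omega)⟩
  have := c.tightValue_R_of_lt hn h0 (w := w) ha le_rfl
  rwa [e] at this

theorem tightValue_R (hn : 1 ≤ n) {w : Finset (Fin n) → ℝ} (h0 : w ∅ = 0) (p q : ℕ) :
    c.tightValue w (c.R p q) = w (c.R p q) := by
  by_cases h : c.IsProperDiagonal p q
  · exact c.tightValue_R_of_lt hn h0 h.1 h.2.1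
  · rcases c.R_eq_empty_or_univ h with e | e
    · rw [e, c.tightValue_empty hn h0, h0]
    · rw [e, c.tightValue_univ hn h0]

theorem associahedron_eq_permPolytope (hn : 1 ≤ n) {w : Finset (Fin n) → ℝ} (h0 : w ∅ = 0) :
    c.associahedron w = permPolytope (c.tightValue w) := by
  apply Set.Subset.antisymm
  · intro x hx
    exact ⟨by rw [hx.1, c.tightValue_univ hn h0], fun I _ _ => c.tightValue_le hn h0 hx I⟩
  · intro x hx
    refine ⟨by rw [hx.1, c.tightValue_univ hn h0], fun a b _ => ?_⟩
    rw [← c.tightValue_R hn h0 a b]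
    exact le_sum_of_mem_permPolytope (c.tightValue_empty hn h0) hx _

/-! ### Supermodularity -/

/-- The union and intersection of `R_{iq}` and `R_{pj}` are `R_{ij}` and `R_{pq}` if `i` and `j` are
up, and the same two sets in the other order if they are down. -/
theorem le_of_same_type (hn : 1 ≤ n) {w : Finset (Fin n) → ℝ} (hw : Supermodular w)
    {p i j q : ℕ} (hpi : p < i) (hij : i < j) (hjq : j < q) (hq : q ≤ n + 1)
    (h : i ∈ c.up ↔ j ∈ c.up) :
    w (c.R i q) + w (c.R p j) ≤ w (c.R i j) + w (c.R p q) := by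
  have := hw (c.R i q) (c.R p j)
  by_cases hi : i ∈ c.up
  · have hj : j ∈ c.up := h.1 hi
    have e1 : c.R i q ∪ c.R p j = c.R i j := by
      ext k
      rw [Finset.mem_union, c.mem_R hn (by omega) (by omega), c.mem_R hn (by omega) (by omega),
        c.mem_R hn (by omega) (by omega)]
      by_cases hk : lab k ∈ c.up <;> by_cases hpu : p ∈ c.up <;> by_cases hqu : q ∈ c.up <;>
        simp [hi, hj, hk, hpu, hqu] <;> omega
    have e2 : c.R i q ∩ c.R p j = c.R p q := by
      ext k
      rw [Finset.mem_inter, c.mem_R hn (by omega) (by omega), c.mem_R hn (by omega) (by omega),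
        c.mem_R hn (by omega) (by omega)]
      by_cases hk : lab k ∈ c.up <;> by_cases hpu : p ∈ c.up <;> by_cases hqu : q ∈ c.up <;>
        simp [hi, hj, hk, hpu, hqu] <;> omega
    rw [e1, e2] at this
    linarith
  · have hj : j ∉ c.up := fun hj => hi (h.2 hj)
    have e1 : c.R i q ∪ c.R p j = c.R p q := by
      ext k
      rw [Finset.mem_union, c.mem_R hn (by omega) (by omega), c.mem_R hn (by omega) (by omega),
        c.mem_R hn (by omega) (by omega)]
      by_cases hk : lab k ∈ c.up <;> by_cases hpu : p ∈ c.up <;> by_cases hqu : q ∈ c.up <;>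
        simp [hi, hj, hk, hpu, hqu] <;> omega
    have e2 : c.R i q ∩ c.R p j = c.R i j := by
      ext k
      rw [Finset.mem_inter, c.mem_R hn (by omega) (by omega), c.mem_R hn (by omega) (by omega),
        c.mem_R hn (by omega) (by omega)]
      by_cases hk : lab k ∈ c.up <;> by_cases hpu : p ∈ c.up <;> by_cases hqu : q ∈ c.up <;>
        simp [hi, hj, hk, hpu, hqu] <;> omega
    rw [e1, e2] at this
    linarith

/-- Here the roles are exchanged: `R_{iq}` and `R_{pj}` are the union and intersection, in some
order, of `R_{ij}` and `R_{pq}`. -/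
theorem le_of_mixed_type (hn : 1 ≤ n) {w : Finset (Fin n) → ℝ} (hw : Supermodular w)
    {p i j q : ℕ} (hpi : p < i) (hij : i < j) (hjq : j < q) (hq : q ≤ n + 1)
    (h : ¬ (i ∈ c.up ↔ j ∈ c.up)) :
    w (c.R i j) + w (c.R p q) ≤ w (c.R i q) + w (c.R p j) := by
  have := hw (c.R i j) (c.R p q)
  by_cases hi : i ∈ c.up
  · have hj : j ∉ c.up := fun hj => h (iff_of_true hi hj)
    have e1 : c.R i j ∪ c.R p q = c.R i q := by
      ext k
      rw [Finset.mem_union, c.mem_R hn (by omega) (by omega), c.mem_R hn (by omega) (by omega),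
        c.mem_R hn (by omega) (by omega)]
      by_cases hk : lab k ∈ c.up <;> by_cases hpu : p ∈ c.up <;> by_cases hqu : q ∈ c.up <;>
        simp [hi, hj, hk, hpu, hqu] <;> omega
    have e2 : c.R i j ∩ c.R p q = c.R p j := by
      ext k
      rw [Finset.mem_inter, c.mem_R hn (by omega) (by omega), c.mem_R hn (by omega) (by omega),
        c.mem_R hn (by omega) (by omega)]
      by_cases hk : lab k ∈ c.up <;> by_cases hpu : p ∈ c.up <;> by_cases hqu : q ∈ c.up <;>
        simp [hi, hj, hk, hpu, hqu] <;> omega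
    rw [e1, e2] at this
    linarith
  · have hj : j ∈ c.up := by tauto
    have e1 : c.R i j ∪ c.R p q = c.R p j := by
      ext k
      rw [Finset.mem_union, c.mem_R hn (by omega) (by omega), c.mem_R hn (by omega) (by omega),
        c.mem_R hn (by omega) (by omega)]
      by_cases hk : lab k ∈ c.up <;> by_cases hpu : p ∈ c.up <;> by_cases hqu : q ∈ c.up <;>
        simp [hi, hj, hk, hpu, hqu] <;> omega
    have e2 : c.R i j ∩ c.R p q = c.R i q := by
      ext k
      rw [Finset.mem_inter, c.mem_R hn (by omega) (by omega), c.mem_R hn (by omega) (by omega),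
        c.mem_R hn (by omega) (by omega)]
      by_cases hk : lab k ∈ c.up <;> by_cases hpu : p ∈ c.up <;> by_cases hqu : q ∈ c.up <;>
        simp [hi, hj, hk, hpu, hqu] <;> omega
    rw [e1, e2] at this
    linarith

theorem edgeWeight_mixed (w : Finset (Fin n) → ℝ) (p i j q : ℕ) :
    c.edgeWeight w i j + c.edgeWeight w p q - c.edgeWeight w i q - c.edgeWeight w p j =
      w (c.R i j) + w (c.R p q) - w (c.R i q) - w (c.R p j) := by
  simp only [edgeWeight]
  ring

theorem supermodular_tightValue (hn : 1 ≤ n) {w : Finset (Fin n) → ℝ} (hw : Supermodular w) :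
    Supermodular (c.tightValue w) := by
  refine supermodular_of_local _ fun I i j hij hi hj => ?_
  have hij' : lab i < lab j := lab_lt_lab.2 hij
  have hjn : lab j < n + 1 := Nat.lt_succ_of_le (lab_le j)
  -- `K` will be `I` together with those of `i`, `j` that are down, so that its path misses both
  -- labels. A down element enters the set by leaving the path, which explains the reversed
  -- inequality when the types differ.
  have key : ∀ K : Finset (Fin n), lab i ∉ c.pathSet K → lab j ∉ c.pathSet K →
      ((lab i ∈ c.up ↔ lab j ∈ c.up) →
        pathSum (c.edgeWeight w) (insert (lab i) (c.pathSet K)) +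
          pathSum (c.edgeWeight w) (insert (lab j) (c.pathSet K)) ≤
        pathSum (c.edgeWeight w) (insert (lab i) (insert (lab j) (c.pathSet K))) +
          pathSum (c.edgeWeight w) (c.pathSet K)) ∧
      (¬ (lab i ∈ c.up ↔ lab j ∈ c.up) →
        pathSum (c.edgeWeight w) (insert (lab i) (insert (lab j) (c.pathSet K))) +
          pathSum (c.edgeWeight w) (c.pathSet K) ≤
        pathSum (c.edgeWeight w) (insert (lab i) (c.pathSet K)) +
          pathSum (c.edgeWeight w) (insert (lab j) (c.pathSet K))) := by
    intro K hiK hjK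
    rcases pathSum_mixed_difference (c.edgeWeight w) (c.zero_mem_pathSet K) (c.succ_mem_pathSet K)
      (lab_pos i) hij' hjn hiK hjK with h | ⟨p, q, hp, hq, hqn, h⟩
    · exact ⟨fun _ => by linarith, fun _ => by linarith⟩
    · rw [edgeWeight_mixed] at h
      refine ⟨fun ht => ?_, fun ht => ?_⟩
      · have := c.le_of_same_type hn hw hp hij' hq hqn ht
        linarith
      · have := c.le_of_mixed_type hn hw hp hij' hq hqn ht
        linarith
  unfold tightValue
  have hne : i ≠ j := hij.ne
  by_cases hiu : lab i ∈ c.up <;> by_cases hju : lab j ∈ c.up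
  · have := (key I (by simp [lab_mem_pathSet, hiu, hi]) (by simp [lab_mem_pathSet, hju, hj])).1
      (iff_of_true hiu hju)
    rw [c.pathSet_insert_of_up (I := I) hiu, c.pathSet_insert_of_up (I := insert j I) hiu,
      c.pathSet_insert_of_up hju]
    exact this
  · have := (key (insert j I) (by simp [lab_mem_pathSet, hiu, hi, hne])
      (by simp [lab_mem_pathSet, hju])).2 (by simp [hiu, hju])
    rw [c.pathSet_insert_of_up (I := I) hiu, c.pathSet_insert_of_up (I := insert j I) hiu,
      c.pathSet_of_down (I := I) hju hj]
    linarith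
  · have := (key (insert i I) (by simp [lab_mem_pathSet, hiu])
      (by simp [lab_mem_pathSet, hju, hj, hne.symm])).2 (by simp [hiu, hju])
    rw [Finset.insert_comm i j I, c.pathSet_insert_of_up (I := I) hju,
      c.pathSet_insert_of_up (I := insert i I) hju, c.pathSet_of_down (I := I) hiu hi,
      Finset.insert_comm (lab j) (lab i)]
    linarith
  · have := (key (insert i (insert j I)) (by simp [lab_mem_pathSet, hiu])
      (by simp [lab_mem_pathSet, hju])).1 (iff_of_false hiu hju)
    have e1 := c.pathSet_of_down (I := insert j I) hiu (by simp [hne, hi])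
    have e2 := c.pathSet_of_down (I := insert i I) hju (by simp [hne.symm, hj])
    have e3 := c.pathSet_of_down (I := I) hiu hi
    rw [Finset.insert_comm j i I] at e2
    rw [e3, e2, e1]
    linarith

end UpDownPartition

/-! ### Indicators of intervals of subsets -/

section Indicator

variable {α : Type*} [DecidableEq α]

/-- The Möbius inverse of the indicator of `A ⊆ I` and `B ∩ I = ∅`. -/
def intervalCoeff (A B J : Finset α) : ℝ :=
  if A ⊆ J ∧ J ⊆ A ∪ B then (-1) ^ (J ∩ B).card else 0

/-- If `A ⊆ I`, the contributing `J` are the sets `A ∪ K` with `K ⊆ B ∩ I`, and the alternating sum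
over `K` vanishes unless `B ∩ I` is empty. -/
theorem sum_powerset_intervalCoeff {A B : Finset α} (hAB : Disjoint A B) (I : Finset α) :
    ∑ J ∈ I.powerset, intervalCoeff A B J = if A ⊆ I ∧ Disjoint B I then 1 else 0 := by
  by_cases hA : A ⊆ I
  · have e : ∑ J ∈ I.powerset, intervalCoeff A B J =
        ∑ K ∈ (B ∩ I).powerset, ((-1 : ℝ)) ^ K.card := by
      simp only [intervalCoeff]
      rw [← Finset.sum_filter]
      refine Finset.sum_nbij' (fun J => J ∩ B) (fun K => A ∪ K) ?_ ?_ ?_ ?_ ?_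
      · intro J hJ
        simp only [Finset.mem_filter, Finset.mem_powerset] at hJ ⊢
        intro x hx
        simp only [Finset.mem_inter] at hx ⊢
        exact ⟨hx.2, hJ.1 hx.1⟩
      · intro K hK
        simp only [Finset.mem_filter, Finset.mem_powerset] at hK ⊢
        exact ⟨Finset.union_subset hA (hK.trans Finset.inter_subset_right),
          Finset.subset_union_left,
          Finset.union_subset_union_right (hK.trans Finset.inter_subset_left)⟩
      · intro J hJ
        simp only [Finset.mem_filter, Finset.mem_powerset] at hJ
        ext x
        have h1 := @hJ.2.1 x
        have h2 := @hJ.2.2 x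
        simp only [Finset.mem_union, Finset.mem_inter] at h2 ⊢
        tauto
      · intro K hK
        simp only [Finset.mem_powerset] at hK
        ext x
        have h1 := @hK x
        have h2 : x ∈ A → x ∉ B := fun h => Finset.disjoint_left.1 hAB h
        simp only [Finset.mem_union, Finset.mem_inter] at h1 ⊢
        tauto
      · intro J _
        rfl
    have h2 := Finset.sum_powerset_neg_one_pow_card (x := B ∩ I)
    rw [e]
    have h3 : ∑ K ∈ (B ∩ I).powerset, ((-1 : ℝ)) ^ K.card =
        ((∑ K ∈ (B ∩ I).powerset, (-1 : ℤ) ^ K.card : ℤ) : ℝ) := by push_cast; rfl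
    rw [h3, h2]
    by_cases hB : Disjoint B I
    · simp [hA, hB, Finset.disjoint_iff_inter_eq_empty.1 hB]
    · have : B ∩ I ≠ ∅ := fun h => hB (Finset.disjoint_iff_inter_eq_empty.2 h)
      simp [hB, this]
  · rw [if_neg fun h => hA h.1]
    refine Finset.sum_eq_zero fun J hJ => ?_
    rw [intervalCoeff, if_neg fun h => hA (h.1.trans (Finset.mem_powerset.1 hJ))]

theorem neg_one_pow_card_toggle {K L : Finset α} {i : α} (h : ∀ j, j ≠ i → (j ∈ K ↔ j ∈ L))
    (hi : i ∈ K ↔ i ∉ L) : (-1 : ℝ) ^ K.card = -(-1) ^ L.card := by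
  by_cases hL : i ∈ L
  · have hK : i ∉ K := fun hh => hi.1 hh hL
    have : L = insert i K := by
      ext j
      rcases eq_or_ne j i with rfl | hj
      · simp [hL]
      · simp [hj, h j hj]
    rw [this, Finset.card_insert_of_notMem hK, pow_succ]
    ring
  · have hK : i ∈ K := hi.2 hL
    have : K = insert i L := by
      ext j
      rcases eq_or_ne j i with rfl | hj
      · simp [hK]
      · simp [hj, h j hj]
    rw [this, Finset.card_insert_of_notMem hL, pow_succ]
    ring

end Indicator

theorem zetaSum_eq_sum_powerset {n : ℕ} {y : Finset (Fin n) → ℝ} (h0 : y ∅ = 0)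
    (I : Finset (Fin n)) : zetaSum y I = ∑ J ∈ I.powerset, y J := by
  rw [zetaSum, ← Finset.sum_filter]
  refine Finset.sum_subset ?_ ?_
  · intro J hJ
    simp only [Finset.mem_filter] at hJ
    exact Finset.mem_powerset.2 hJ.2
  · intro J hJ hJ'
    simp only [Finset.mem_filter, Finset.mem_univ, true_and, not_and] at hJ'
    rcases J.eq_empty_or_nonempty with rfl | h
    · exact h0
    · exact absurd (Finset.mem_powerset.1 hJ) (hJ' h)

namespace UpDownPartition

variable {n : ℕ} (c : UpDownPartition n)

/-! ### Minkowski coefficients -/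

/-- The elements `I` has to contain for `p < q` to be consecutive in the path of `I`. -/
def required (p q : ℕ) : Finset (Fin n) :=
  Finset.univ.filter fun i =>
    (lab i ∈ c.up ∧ (lab i = p ∨ lab i = q)) ∨ (lab i ∉ c.up ∧ p < lab i ∧ lab i < q)

/-- The elements `I` has to avoid for `p < q` to be consecutive in the path of `I`. -/
def forbidden (p q : ℕ) : Finset (Fin n) :=
  Finset.univ.filter fun i =>
    (lab i ∉ c.up ∧ (lab i = p ∨ lab i = q)) ∨ (lab i ∈ c.up ∧ p < lab i ∧ lab i < q)

/-- The pairs of labels `p < q`. -/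
def labelPairs (n : ℕ) : Finset (ℕ × ℕ) :=
  (Finset.range (n + 2) ×ˢ Finset.range (n + 2)).filter fun e => e.1 < e.2

/-- The Minkowski coefficients of the associahedron. -/
noncomputable def minkowskiCoeff (w : Finset (Fin n) → ℝ) (J : Finset (Fin n)) : ℝ :=
  ∑ e ∈ labelPairs n,
    c.edgeWeight w e.1 e.2 * intervalCoeff (c.required e.1 e.2) (c.forbidden e.1 e.2) J

theorem mem_labelPairs {e : ℕ × ℕ} : e ∈ labelPairs n ↔ e.1 < e.2 ∧ e.2 ≤ n + 1 := by
  simp only [labelPairs, Finset.mem_filter, Finset.mem_product, Finset.mem_range]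
  omega

theorem mem_required {p q : ℕ} {i : Fin n} : i ∈ c.required p q ↔
    (lab i ∈ c.up ∧ (lab i = p ∨ lab i = q)) ∨ (lab i ∉ c.up ∧ p < lab i ∧ lab i < q) := by
  simp [required]

theorem mem_forbidden {p q : ℕ} {i : Fin n} : i ∈ c.forbidden p q ↔
    (lab i ∉ c.up ∧ (lab i = p ∨ lab i = q)) ∨ (lab i ∈ c.up ∧ p < lab i ∧ lab i < q) := by
  simp [forbidden]

theorem disjoint_required_forbidden {p q : ℕ} :
    Disjoint (c.required p q) (c.forbidden p q) := by
  rw [Finset.disjoint_left]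
  intro i h1 h2
  rw [mem_required] at h1
  rw [mem_forbidden] at h2
  by_cases hi : lab i ∈ c.up <;> simp [hi] at h1 h2 <;> omega

theorem consecutive_pathSet_iff (I : Finset (Fin n)) {p q : ℕ} (hpq : p < q) (hq : q ≤ n + 1) :
    Consecutive (c.pathSet I) p q ↔ c.required p q ⊆ I ∧ Disjoint (c.forbidden p q) I := by
  constructor
  · rintro ⟨hp, hq', -, hn⟩
    refine ⟨fun i hi => ?_, Finset.disjoint_left.2 fun i hi hiI => ?_⟩
    · rcases c.mem_required.1 hi with ⟨hiu, rfl | rfl⟩ | ⟨hiu, h1, h2⟩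
      · exact (c.lab_mem_pathSet.1 hp).1 hiu
      · exact (c.lab_mem_pathSet.1 hq').1 hiu
      · by_contra hiI
        exact hn (lab i) (c.lab_mem_pathSet.2 (iff_of_false hiu hiI)) h1 h2
    · rcases c.mem_forbidden.1 hi with ⟨hiu, rfl | rfl⟩ | ⟨hiu, h1, h2⟩
      · exact hiu ((c.lab_mem_pathSet.1 hp).2 hiI)
      · exact hiu ((c.lab_mem_pathSet.1 hq').2 hiI)
      · exact hn (lab i) (c.lab_mem_pathSet.2 (iff_of_true hiu hiI)) h1 h2
  · rintro ⟨h1, h2⟩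
    rw [Finset.disjoint_left] at h2
    have hmem : ∀ r, r ≤ n + 1 → (r = p ∨ r = q) → r ∈ c.pathSet I := by
      intro r hr hrpq
      by_cases hr0 : r = 0
      · exact hr0 ▸ c.zero_mem_pathSet I
      by_cases hrn : r = n + 1
      · exact hrn ▸ c.succ_mem_pathSet I
      obtain ⟨i, rfl⟩ := exists_lab (n := n) hr0 (by omega)
      rw [lab_mem_pathSet]
      by_cases hi : lab i ∈ c.up
      · exact iff_of_true hi (h1 (c.mem_required.2 (Or.inl ⟨hi, hrpq⟩)))
      · exact iff_of_false hi (h2 (c.mem_forbidden.2 (Or.inl ⟨hi, hrpq⟩)))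
    refine ⟨hmem p (by omega) (Or.inl rfl), hmem q hq (Or.inr rfl), hpq, fun r hr hpr hrq => ?_⟩
    obtain ⟨i, rfl⟩ := exists_lab (n := n) (r := r) (by omega) (by omega)
    rw [lab_mem_pathSet] at hr
    by_cases hi : lab i ∈ c.up
    · exact h2 (c.mem_forbidden.2 (Or.inr ⟨hi, hpr, hrq⟩)) (hr.1 hi)
    · exact hi (hr.2 (h1 (c.mem_required.2 (Or.inr ⟨hi, hpr, hrq⟩))))

/-- After exchanging the sums, each pair `p < q` is weighted by the indicator of being consecutive
on the path of `I`, leaving exactly the path sum. -/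
theorem sum_powerset_minkowskiCoeff (w : Finset (Fin n) → ℝ) (I : Finset (Fin n)) :
    ∑ J ∈ I.powerset, c.minkowskiCoeff w J = c.tightValue w I := by
  simp only [minkowskiCoeff]
  rw [Finset.sum_comm]
  have : consecutivePairs (c.pathSet I) ⊆ labelPairs n := by
    intro e he
    rw [mem_consecutivePairs] at he
    exact mem_labelPairs.2 ⟨he.2.2.1, (c.mem_pathSet.1 he.2.1).1⟩
  rw [tightValue, pathSum, ← Finset.inter_eq_right.2 this, ← Finset.sum_ite_mem]
  refine Finset.sum_congr rfl fun e he => ?_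
  rw [mem_labelPairs] at he
  rw [← Finset.mul_sum, sum_powerset_intervalCoeff c.disjoint_required_forbidden,
    mul_ite, mul_one, mul_zero]
  exact if_congr (by rw [mem_consecutivePairs, c.consecutive_pathSet_iff I he.1 he.2]) rfl rfl

theorem tightValue_eq_zetaSum (hn : 1 ≤ n) {w : Finset (Fin n) → ℝ} (h0 : w ∅ = 0) :
    c.tightValue w = zetaSum (c.minkowskiCoeff w) := by
  funext I
  rw [zetaSum_eq_sum_powerset, sum_powerset_minkowskiCoeff]
  have := c.sum_powerset_minkowskiCoeff w ∅
  rw [c.tightValue_empty hn h0] at this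
  simpa using this

/-! ### Sets with a single down interval -/

/-- `(a, b)` is a down interval spanning the set `J`. -/
def IsSpan (J : Finset (Fin n)) (a b : ℕ) : Prop :=
  a ∈ c.downBar ∧ b ∈ c.downBar ∧ (∀ i ∈ J, a < lab i ∧ lab i < b) ∧
    ∀ i : Fin n, lab i ∉ c.up → a < lab i → lab i < b → i ∈ J

theorem mem_downInterval {a b : ℕ} {i : Fin n} :
    i ∈ c.downInterval a b ↔ lab i ∉ c.up ∧ a < lab i ∧ lab i < b := by
  simp [downInterval]

theorem mem_downIntervals {I : Finset (Fin n)} {a b : ℕ} :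
    (a, b) ∈ c.downIntervals I ↔ (a ∈ c.downBar ∧ b ∈ c.downBar) ∧ a < b ∧
      (∀ i ∈ I, lab i ≠ a ∧ lab i ≠ b) ∧
      (((c.downInterval a b : Finset (Fin n)).Nonempty ∧ c.downInterval a b ⊆ I) ∨
        ((c.downInterval a b : Finset (Fin n)) = ∅ ∧
          ∃ i ∈ I, lab i ∈ c.up ∧ a < lab i ∧ lab i < b)) := by
  simp only [downIntervals, Finset.mem_filter, Finset.mem_product]

theorem downInterval_subset_of_mem {I : Finset (Fin n)} {a b : ℕ}
    (h : (a, b) ∈ c.downIntervals I) : c.downInterval a b ⊆ I := by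
  obtain ⟨-, -, -, h | h⟩ := c.mem_downIntervals.1 h
  · exact h.2
  · simp [h.1]

theorem exists_mem_of_mem_downIntervals {I : Finset (Fin n)} {a b : ℕ}
    (h : (a, b) ∈ c.downIntervals I) : ∃ i ∈ I, a < lab i ∧ lab i < b := by
  obtain ⟨-, -, -, ⟨⟨i, hi⟩, hs⟩ | ⟨-, i, hi, -, hab⟩⟩ := c.mem_downIntervals.1 h
  · exact ⟨i, hs hi, (c.mem_downInterval.1 hi).2⟩
  · exact ⟨i, hi, hab⟩

theorem exists_lab_of_mem_downBar {r : ℕ} (hr : r ∈ c.downBar) (h0 : r ≠ 0) (h1 : r ≠ n + 1) :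
    ∃ i : Fin n, lab i = r ∧ lab i ∉ c.up := by
  rw [mem_downBar] at hr
  obtain ⟨i, rfl⟩ := exists_lab (n := n) h0 (by omega)
  exact ⟨i, rfl, hr.2⟩

theorem mem_downIntervals_of_isSpan {J : Finset (Fin n)} (hJ : J.Nonempty) {a b : ℕ}
    (h : c.IsSpan J a b) : (a, b) ∈ c.downIntervals J := by
  obtain ⟨ha, hb, hJab, hD⟩ := h
  obtain ⟨i, hi⟩ := hJ
  have := hJab i hi
  refine c.mem_downIntervals.2 ⟨⟨ha, hb⟩, by omega, fun j hj => ?_, ?_⟩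
  · have := hJab j hj
    omega
  · rcases (c.downInterval a b : Finset (Fin n)).eq_empty_or_nonempty with he | he
    · refine Or.inr ⟨he, i, hi, ?_, this⟩
      by_contra hiu
      have : i ∈ (c.downInterval a b : Finset (Fin n)) := c.mem_downInterval.2 ⟨hiu, this⟩
      simp [he] at this
    · refine Or.inl ⟨he, fun j hj => ?_⟩
      obtain ⟨h1, h2, h3⟩ := c.mem_downInterval.1 hj
      exact hD j h1 h2 h3

/-- Another down interval meets `J`, so it overlaps `(a, b)`. An end-point inside `(a, b)` would be
a down label of `J`; one beyond `a` or `b` would force that label into `J`. -/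
theorem downIntervals_eq_of_isSpan {J : Finset (Fin n)} (hJ : J.Nonempty) {a b : ℕ}
    (h : c.IsSpan J a b) : c.downIntervals J = {(a, b)} := by
  refine Finset.eq_singleton_iff_unique_mem.2 ⟨c.mem_downIntervals_of_isSpan hJ h, ?_⟩
  rintro ⟨a', b'⟩ hab
  obtain ⟨i, hi, hai, hib⟩ := c.exists_mem_of_mem_downIntervals hab
  have hsub := c.downInterval_subset_of_mem hab
  obtain ⟨⟨ha', hb'⟩, -, hne, -⟩ := c.mem_downIntervals.1 hab
  obtain ⟨ha, hb, hJab, hD⟩ := h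
  have hiab := hJab i hi
  have hin := lab_le i
  have hbn := (c.mem_downBar.1 hb).1
  have hbn' := (c.mem_downBar.1 hb').1
  have h1 : a' = a := by
    rcases lt_trichotomy a' a with hlt | h | hlt
    · obtain ⟨k, rfl, hku⟩ := c.exists_lab_of_mem_downBar ha (by omega) (by omega)
      have := (hJab k (hsub (c.mem_downInterval.2 ⟨hku, hlt, by omega⟩))).1
      omega
    · exact h
    · obtain ⟨k, rfl, hku⟩ := c.exists_lab_of_mem_downBar ha' (by omega) (by omega)
      exact absurd rfl (hne k (hD k hku hlt (by omega))).1
  have h2 : b' = b := by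
    rcases lt_trichotomy b b' with hlt | h | hlt
    · obtain ⟨k, rfl, hku⟩ := c.exists_lab_of_mem_downBar hb (by omega) (by omega)
      have := (hJab k (hsub (c.mem_downInterval.2 ⟨hku, by omega, hlt⟩))).2
      omega
    · exact h.symm
    · obtain ⟨k, rfl, hku⟩ := c.exists_lab_of_mem_downBar hb' (by omega) (by omega)
      exact absurd rfl (hne k (hD k hku (by omega) hlt)).2
  rw [h1, h2]

/-- Among the labels of a set containing `0` and `n + 1`, the closest ones below and above. -/
theorem exists_closest {S : Finset ℕ} (h0 : 0 ∈ S) {N x y : ℕ} (hN : N ∈ S) (hx : 0 < x)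
    (hy : y < N) : ∃ a ∈ S, ∃ b ∈ S, a < x ∧ y < b ∧ (∀ s ∈ S, s < x → s ≤ a) ∧
      ∀ s ∈ S, y < s → b ≤ s := by
  have h1 : (S.filter (· < x)).Nonempty := ⟨0, by simp [h0, hx]⟩
  have h2 : (S.filter (y < ·)).Nonempty := ⟨N, by simp [hN, hy]⟩
  have hp := Finset.mem_filter.1 (Finset.max'_mem _ h1)
  have hq := Finset.mem_filter.1 (Finset.min'_mem _ h2)
  exact ⟨_, hp.1, _, hq.1, hp.2, hq.2,
    fun s hs hsx => Finset.le_max' _ _ (Finset.mem_filter.2 ⟨hs, hsx⟩),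
    fun s hs hsy => Finset.min'_le _ _ (Finset.mem_filter.2 ⟨hs, hsy⟩)⟩

/-- Around any element of `J`, the nearest extended down labels outside `J` bound a down interval of
`J`. By uniqueness it is `(a, b)`, so every element lies there. -/
theorem isSpan_of_downIntervals_eq {J : Finset (Fin n)} {a b : ℕ}
    (h : c.downIntervals J = {(a, b)}) : c.IsSpan J a b := by
  have hab : (a, b) ∈ c.downIntervals J := by simp [h]
  have hsub := c.downInterval_subset_of_mem hab
  obtain ⟨⟨ha, hb⟩, -⟩ := c.mem_downIntervals.1 hab
  refine ⟨ha, hb, fun i hi => ?_, fun i h1 h2 h3 => hsub (c.mem_downInterval.2 ⟨h1, h2, h3⟩)⟩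
  have hin := lab_le i
  have hlab : ∀ r, (∀ j ∈ J, lab j ≠ r) ↔ r ∉ J.image lab := by
    intro r
    simp only [Finset.mem_image, not_exists, not_and, ne_eq]
  have hmem : ∀ r, r ∈ c.downBar \ J.image lab ↔ r ∈ c.downBar ∧ ∀ j ∈ J, lab j ≠ r := by
    intro r
    rw [Finset.mem_sdiff, hlab]
  have h0 : 0 ∈ c.downBar \ J.image lab := (hmem 0).2
    ⟨c.mem_downBar.2 ⟨by omega, c.zero_notMem_up⟩, fun j _ => (lab_pos j).ne'⟩
  have hN : n + 1 ∈ c.downBar \ J.image lab := (hmem _).2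
    ⟨c.mem_downBar.2 ⟨le_rfl, c.succ_notMem_up⟩, fun j _ => by have := lab_le j; omega⟩
  obtain ⟨p, hp, q, hq, hpi, hiq, hpmax, hqmin⟩ := exists_closest h0 hN (lab_pos i)
    (Nat.lt_succ_of_le hin)
  rw [hmem] at hp hq
  have hspan : (c.downInterval p q : Finset (Fin n)) ⊆ J := by
    intro j hj
    obtain ⟨h1, h2, h3⟩ := c.mem_downInterval.1 hj
    by_contra hjJ
    have hjn := lab_le j
    have hjm := (hmem (lab j)).2 ⟨c.mem_downBar.2 ⟨by omega, h1⟩,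
      fun k hk e => hjJ (lab_injective e ▸ hk)⟩
    have e1 := hpmax _ hjm
    have e2 := hqmin _ hjm
    have e3 : lab j ≠ lab i := fun e => hjJ (lab_injective e ▸ hi)
    omega
  have hpq : (p, q) ∈ c.downIntervals J := by
    refine c.mem_downIntervals.2 ⟨⟨hp.1, hq.1⟩, by omega,
      fun j hj => ⟨hp.2 j hj, hq.2 j hj⟩, ?_⟩
    rcases (c.downInterval p q : Finset (Fin n)).eq_empty_or_nonempty with he | he
    · refine Or.inr ⟨he, i, hi, ?_, hpi, hiq⟩
      by_contra hiu
      have : i ∈ (c.downInterval p q : Finset (Fin n)) := c.mem_downInterval.2 ⟨hiu, hpi, hiq⟩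
      simp [he] at this
    · exact Or.inl ⟨he, hspan⟩
  rw [h, Finset.mem_singleton, Prod.mk.injEq] at hpq
  rw [← hpq.1, ← hpq.2]
  exact ⟨hpi, hiq⟩

theorem required_forbidden_bounds {J : Finset (Fin n)} {p q : ℕ} (hpq : p < q)
    (h : J ⊆ c.required p q ∪ c.forbidden p q) {i : Fin n} (hi : i ∈ J) :
    p ≤ lab i ∧ lab i ≤ q := by
  have := h hi
  rw [Finset.mem_union, mem_required, mem_forbidden] at this
  omega

/-- Let `a` and `b` be the extended down labels nearest to `J` from below and above. A down label
between them lies between `min J` and `max J`; it is one of these or lies strictly between `p` and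
`q`, and is then required. -/
theorem exists_isSpan {J : Finset (Fin n)} (hJ : J.Nonempty) {p q : ℕ} (hpq : p < q)
    (h1 : c.required p q ⊆ J) (h2 : J ⊆ c.required p q ∪ c.forbidden p q) :
    ∃ a b, c.IsSpan J a b := by
  have hmin := J.min'_mem hJ
  have hmax := J.max'_mem hJ
  obtain ⟨a, ha, b, hb, hag, hGb, hamax, hbmin⟩ := exists_closest
    (c.mem_downBar.2 ⟨by omega, c.zero_notMem_up⟩) (c.mem_downBar.2 ⟨le_rfl, c.succ_notMem_up⟩)
    (lab_pos (J.min' hJ)) (Nat.lt_succ_of_le (lab_le (J.max' hJ)))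
  refine ⟨a, b, ha, hb, fun i hi => ?_, fun i hiu hai hib => ?_⟩
  · have h3 := lab_le_lab.2 (J.min'_le i hi)
    have h4 := lab_le_lab.2 (J.le_max' i hi)
    omega
  · have hin := lab_le i
    have himem := c.mem_downBar.2 ⟨by omega, hiu⟩
    have h3 := hamax _ himem
    have h4 := hbmin _ himem
    have h5 := c.required_forbidden_bounds hpq h2 hmin
    have h6 := c.required_forbidden_bounds hpq h2 hmax
    by_cases e1 : i = J.min' hJ
    · rwa [e1]
    by_cases e2 : i = J.max' hJ
    · rwa [e2]
    have e1' : lab i ≠ lab (J.min' hJ) := fun e => e1 (lab_injective e)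
    have e2' : lab i ≠ lab (J.max' hJ) := fun e => e2 (lab_injective e)
    exact h1 (c.mem_required.2 (Or.inr ⟨hiu, by omega, by omega⟩))

theorem minkowskiCoeff_eq_zero (w : Finset (Fin n) → ℝ) {J : Finset (Fin n)} (hJ : J.Nonempty)
    (h : (c.downIntervals J).card ≠ 1) : c.minkowskiCoeff w J = 0 := by
  refine Finset.sum_eq_zero fun e he => ?_
  rw [intervalCoeff, if_neg, mul_zero]
  rintro ⟨h1, h2⟩
  obtain ⟨a, b, hab⟩ := c.exists_isSpan hJ (mem_labelPairs.1 he).1 h1 h2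
  rw [c.downIntervals_eq_of_isSpan hJ hab, Finset.card_singleton] at h
  exact h rfl

/-- All of `J` lies in `[p, q]`. If `p < a`, the down label `a` would be required although it is not
in `J`. If `p > a`, then `p` is itself a label of `J`, hence the smallest. The argument for `q` is
symmetric. -/
theorem required_forbidden_iff {J : Finset (Fin n)} (hJ : J.Nonempty) {a b : ℕ}
    (h : c.IsSpan J a b) {p q : ℕ} (hpq : p < q) (hq : q ≤ n + 1) :
    (c.required p q ⊆ J ∧ J ⊆ c.required p q ∪ c.forbidden p q) ↔
      (p = a ∨ p = lab (J.min' hJ)) ∧ (q = b ∨ q = lab (J.max' hJ)) := by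
  obtain ⟨ha, hb, hJab, hD⟩ := h
  have hmin := J.min'_mem hJ
  have hmax := J.max'_mem hJ
  have hmin1 := hJab _ hmin
  have hmax1 := hJab _ hmax
  have hmin0 := lab_pos (J.min' hJ)
  have hmaxn := lab_le (J.max' hJ)
  have hle := lab_le_lab.2 (J.min'_le _ hmax)
  have haD := c.mem_downBar.1 ha
  have hbD := c.mem_downBar.1 hb
  constructor
  · rintro ⟨h1, h2⟩
    have h5 := c.required_forbidden_bounds hpq h2 hmin
    have h6 := c.required_forbidden_bounds hpq h2 hmax
    constructor
    · by_contra hcon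
      rw [not_or] at hcon
      rcases lt_trichotomy p a with hlt | heq | hlt
      · obtain ⟨k, rfl, hku⟩ := c.exists_lab_of_mem_downBar ha (by omega) (by omega)
        have := hJab k (h1 (c.mem_required.2 (Or.inr ⟨hku, hlt, by omega⟩)))
        omega
      · exact hcon.1 heq
      · obtain ⟨k, rfl⟩ := exists_lab (n := n) (r := p) (by omega) (by omega)
        have hk : k ∈ J := by
          by_cases hku : lab k ∈ c.up
          · exact h1 (c.mem_required.2 (Or.inl ⟨hku, Or.inl rfl⟩))
          · exact hD k hku hlt (by omega)
        have := lab_le_lab.2 (J.min'_le k hk)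
        omega
    · by_contra hcon
      rw [not_or] at hcon
      rcases lt_trichotomy b q with hlt | heq | hlt
      · obtain ⟨k, rfl, hku⟩ := c.exists_lab_of_mem_downBar hb (by omega) (by omega)
        have := hJab k (h1 (c.mem_required.2 (Or.inr ⟨hku, by omega, hlt⟩)))
        omega
      · exact hcon.1 heq.symm
      · obtain ⟨k, rfl⟩ := exists_lab (n := n) (r := q) (by omega) (by omega)
        have hk : k ∈ J := by
          by_cases hku : lab k ∈ c.up
          · exact h1 (c.mem_required.2 (Or.inl ⟨hku, Or.inr rfl⟩))
          · exact hD k hku (by omega) hlt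
        have := lab_le_lab.2 (J.le_max' k hk)
        omega
  · rintro ⟨h1, h2⟩
    refine ⟨fun i hi => ?_, fun i hi => ?_⟩
    · rcases c.mem_required.1 hi with ⟨hiu, hipq⟩ | ⟨hiu, h3, h4⟩
      · have e1 : lab i ≠ a := fun e => haD.2 (e ▸ hiu)
        have e2 : lab i ≠ b := fun e => hbD.2 (e ▸ hiu)
        have : lab i = lab (J.min' hJ) ∨ lab i = lab (J.max' hJ) := by omega
        rcases this with e | e
        · rwa [lab_injective e]
        · rwa [lab_injective e]
      · exact hD i hiu (by omega) (by omega)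
    · have h3 := lab_le_lab.2 (J.min'_le i hi)
      have h4 := lab_le_lab.2 (J.le_max' i hi)
      rw [Finset.mem_union, mem_required, mem_forbidden]
      by_cases hiu : lab i ∈ c.up <;> simp only [hiu, not_true_eq_false, not_false_eq_true,
        true_and, false_and, or_false, false_or] <;> omega

/-- Both sides are the up part of `J`; this matches the Möbius sign with the sign in the theorem. -/
theorem sdiff_R_of_isSpan (hn : 1 ≤ n) {J : Finset (Fin n)} (hJ : J.Nonempty) {a b : ℕ}
    (h : c.IsSpan J a b) : J \ c.R a b = J ∩ c.forbidden a b := by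
  obtain ⟨ha, hb, hJab, hD⟩ := h
  have haD := c.mem_downBar.1 ha
  have hbD := c.mem_downBar.1 hb
  obtain ⟨j, hj⟩ := hJ
  have := hJab j hj
  ext i
  rw [Finset.mem_sdiff, Finset.mem_inter, c.mem_R hn (by omega) hbD.1, mem_forbidden]
  refine and_congr_right fun hi => ?_
  have := hJab i hi
  by_cases hiu : lab i ∈ c.up <;> simp [hiu, haD.2, hbD.2] <;> omega

theorem minkowskiCoeff_of_isSpan (hn : 1 ≤ n) (w : Finset (Fin n) → ℝ) (h0 : w ∅ = 0)
    {J : Finset (Fin n)} (hJ : J.Nonempty) {a b γ Γ : ℕ} (h : c.IsSpan J a b)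
    (hγ : γ = lab (J.min' hJ)) (hΓ : Γ = lab (J.max' hJ)) :
    c.minkowskiCoeff w J = (-1) ^ (J \ c.R a b).card *
      (w (c.R a b) - w (c.R a Γ) - w (c.R γ b) + w (c.R γ Γ)) := by
  have hiff := fun p q (hpq : p < q) (hq : q ≤ n + 1) =>
    c.required_forbidden_iff hJ h hpq hq
  rw [← hγ, ← hΓ] at hiff
  rw [c.sdiff_R_of_isSpan hn hJ h]
  obtain ⟨ha, hb, hJab, hD⟩ := h
  have hmin := J.min'_mem hJ
  have hmax := J.max'_mem hJ
  have hγab := hJab _ hmin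
  have hΓab := hJab _ hmax
  have hle := lab_le_lab.2 (J.min'_le _ hmax)
  have haD := c.mem_downBar.1 ha
  have hbD := c.mem_downBar.1 hb
  rw [← hγ] at hγab hle
  rw [← hΓ] at hΓab hle
  set s : ℝ := (-1) ^ (J ∩ c.forbidden a b).card with hs
  have hmemab : ∀ i ∈ J, (i ∈ c.forbidden a b ↔ lab i ∈ c.up) := by
    intro i hi
    have := hJab i hi
    rw [mem_forbidden]
    by_cases hiu : lab i ∈ c.up <;>
      simp only [hiu, not_true_eq_false, not_false_eq_true, true_and, false_and, or_false, false_or,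
        iff_true, iff_false] <;> omega
  have hbound : ∀ i ∈ J, γ ≤ lab i ∧ lab i ≤ Γ := by
    intro i hi
    rw [hγ, hΓ]
    exact ⟨lab_le_lab.2 (J.min'_le i hi), lab_le_lab.2 (J.le_max' i hi)⟩
  -- Moving the end-point from `b` to `Γ` changes the status of `max J` alone: a down `Γ` becomes
  -- forbidden, an up `Γ` ceases to be.
  have hsaΓ : (-1 : ℝ) ^ (J ∩ c.forbidden a Γ).card = -s := by
    refine neg_one_pow_card_toggle (i := J.max' hJ) (fun j hj => ?_) ?_
    · rw [Finset.mem_inter, Finset.mem_inter]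
      refine and_congr_right fun hjJ => ?_
      have h1 := hJab j hjJ
      have h2 := hbound j hjJ
      have h3 : lab j ≠ Γ := fun e => hj (lab_injective (e.trans hΓ))
      rw [hmemab j hjJ, mem_forbidden]
      by_cases hiu : lab j ∈ c.up <;>
        simp only [hiu, not_true_eq_false, not_false_eq_true, true_and, false_and, or_false,
          false_or, iff_true, iff_false] <;> omega
    · simp only [Finset.mem_inter, hmax, true_and]
      rw [hmemab _ hmax, mem_forbidden, ← hΓ]
      by_cases hiu : Γ ∈ c.up <;> simp [hiu]
  have hsγb : (-1 : ℝ) ^ (J ∩ c.forbidden γ b).card = -s := by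
    refine neg_one_pow_card_toggle (i := J.min' hJ) (fun j hj => ?_) ?_
    · rw [Finset.mem_inter, Finset.mem_inter]
      refine and_congr_right fun hjJ => ?_
      have h1 := hJab j hjJ
      have h2 := hbound j hjJ
      have h3 : lab j ≠ γ := fun e => hj (lab_injective (e.trans hγ))
      rw [hmemab j hjJ, mem_forbidden]
      by_cases hiu : lab j ∈ c.up <;>
        simp only [hiu, not_true_eq_false, not_false_eq_true, true_and, false_and, or_false,
          false_or, iff_true, iff_false] <;> omega
    · simp only [Finset.mem_inter, hmin, true_and]
      rw [hmemab _ hmin, mem_forbidden, ← hγ]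
      by_cases hiu : γ ∈ c.up <;> simp [hiu]
  have hterm : ∀ p q, p < q → q ≤ n + 1 → (p = a ∨ p = γ) → (q = b ∨ q = Γ) →
      intervalCoeff (c.required p q) (c.forbidden p q) J =
        (-1 : ℝ) ^ (J ∩ c.forbidden p q).card := by
    intro p q hpq hq h1 h2
    rw [intervalCoeff, if_pos ((hiff p q hpq hq).2 ⟨h1, h2⟩)]
  have hzero : ∀ p q, p < q → q ≤ n + 1 → ¬ ((p = a ∨ p = γ) ∧ (q = b ∨ q = Γ)) →
      intervalCoeff (c.required p q) (c.forbidden p q) J = 0 := by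
    intro p q hpq hq h1
    rw [intervalCoeff, if_neg (fun hh => h1 ((hiff p q hpq hq).1 hh))]
  have hea : (if a ∈ c.up then (1 : ℝ) else 0) = 0 := if_neg haD.2
  have heb : (if b ∈ c.up then (1 : ℝ) else 0) = 0 := if_neg hbD.2
  rcases hle.eq_or_lt with heq | hlt
  · subst heq
    have hsub : ({(a, b), (a, γ), (γ, b)} : Finset (ℕ × ℕ)) ⊆ labelPairs n := by
      intro e he
      simp only [Finset.mem_insert, Finset.mem_singleton] at he
      rw [mem_labelPairs]
      rcases he with rfl | rfl | rfl <;> exact ⟨by simp only; omega, by simp only; omega⟩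
    rw [minkowskiCoeff, ← Finset.sum_subset hsub, Finset.sum_insert, Finset.sum_insert,
      Finset.sum_singleton]
    · simp only
      rw [hterm a b (by omega) (by omega) (by simp) (by simp),
        hterm a γ (by omega) (by omega) (by simp) (by simp),
        hterm γ b (by omega) (by omega) (by simp) (by simp), hsaΓ, hsγb, ← hs]
      -- For a singleton `J` the pair `(γ, γ)` is not among the label pairs. The term `w (R_{γγ})`
      -- is supplied by the two half corrections at `γ` in the edges `(a, γ)` and `(γ, b)`; for `γ <
      -- Γ` the corrections cancel.
      have hR : w (c.R γ γ) = w Finset.univ * if γ ∈ c.up then 1 else 0 := by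
        rw [c.R_eq_of_not_isProperDiagonal fun hh => lt_irrefl _ hh.1, if_neg (by omega)]
        by_cases hu : γ ∈ c.up <;> simp [hu, h0]
      rw [hR]
      simp only [edgeWeight, hea, heb]
      ring
    · simp only [Finset.mem_singleton, Prod.mk.injEq]
      omega
    · simp only [Finset.mem_insert, Finset.mem_singleton, Prod.mk.injEq]
      omega
    · intro e he hne
      rw [mem_labelPairs] at he
      rw [hzero e.1 e.2 he.1 he.2, mul_zero]
      simp only [Finset.mem_insert, Finset.mem_singleton, Prod.ext_iff] at hne
      omega
  · have hsγΓ : (-1 : ℝ) ^ (J ∩ c.forbidden γ Γ).card = s := by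
      rw [neg_one_pow_card_toggle (i := J.min' hJ) (L := J ∩ c.forbidden a Γ), hsaΓ, neg_neg]
      · intro j hj
        rw [Finset.mem_inter, Finset.mem_inter]
        refine and_congr_right fun hjJ => ?_
        have h1 := hJab j hjJ
        have h2 := hbound j hjJ
        have h3 : lab j ≠ γ := fun e => hj (lab_injective (e.trans hγ))
        rw [mem_forbidden, mem_forbidden]
        by_cases hiu : lab j ∈ c.up <;>
          simp only [hiu, not_true_eq_false, not_false_eq_true, true_and, false_and, or_false,
            false_or] <;> omega
      · simp only [Finset.mem_inter, hmin, true_and]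
        rw [mem_forbidden, mem_forbidden, ← hγ]
        by_cases hiu : γ ∈ c.up <;> simp only [hiu, not_true_eq_false, not_false_eq_true, true_and,
          false_and, or_false, false_or, true_or, true_iff] <;> omega
    have hsub : ({(a, b), (a, Γ), (γ, b), (γ, Γ)} : Finset (ℕ × ℕ)) ⊆ labelPairs n := by
      intro e he
      simp only [Finset.mem_insert, Finset.mem_singleton] at he
      rw [mem_labelPairs]
      rcases he with rfl | rfl | rfl | rfl <;> exact ⟨by simp only; omega, by simp only; omega⟩
    rw [minkowskiCoeff, ← Finset.sum_subset hsub, Finset.sum_insert, Finset.sum_insert,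
      Finset.sum_insert, Finset.sum_singleton]
    · simp only
      rw [hterm a b (by omega) (by omega) (by simp) (by simp),
        hterm a Γ (by omega) (by omega) (by simp) (by simp),
        hterm γ b (by omega) (by omega) (by simp) (by simp),
        hterm γ Γ hlt (by omega) (by simp) (by simp), hsaΓ, hsγb, hsγΓ, ← hs]
      simp only [edgeWeight, hea, heb]
      ring
    · simp only [Finset.mem_singleton, Prod.mk.injEq]
      omega
    · simp only [Finset.mem_insert, Finset.mem_singleton, Prod.mk.injEq]
      omega
    · simp only [Finset.mem_insert, Finset.mem_singleton, Prod.mk.injEq]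
      omega
    · intro e he hne
      rw [mem_labelPairs] at he
      rw [hzero e.1 e.2 he.1 he.2, mul_zero]
      simp only [Finset.mem_insert, Finset.mem_singleton, Prod.ext_iff] at hne
      omega

end UpDownPartition

/-- Here `z` are the tight values and `y` the (unique) Minkowski coefficients of the
associahedron; `(c.downIntervals I).card` is the number `v` of nested components of `I`. -/
theorem mainTheorem1 (n : ℕ) (hn : 1 ≤ n) (c : UpDownPartition n)
    (w : Finset (Fin n) → ℝ) (hw : InDeformationCone w) :
    ∃ z y : Finset (Fin n) → ℝ,
      IsTight (c.associahedron w) z ∧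
      c.associahedron w = permPolytope z ∧
      (∀ a b : ℕ, c.IsProperDiagonal a b → z (c.R a b) = w (c.R a b)) ∧
      (∀ y' : Finset (Fin n) → ℝ, IsMinkowskiDecomposition (c.associahedron w) y' ↔
        ∀ I : Finset (Fin n), I.Nonempty → y' I = y I) ∧
      ∀ (I : Finset (Fin n)) (hI : I.Nonempty),
        (∀ a b γ Γ : ℕ, c.downIntervals I = {(a, b)} →
          γ = lab (I.min' hI) → Γ = lab (I.max' hI) →
          y I = (-1) ^ (I \ c.R a b).card *
            (z (c.R a b) - z (c.R a Γ) - z (c.R γ b) + z (c.R γ Γ))) ∧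
        ((c.downIntervals I).card ≠ 1 → y I = 0) := by
  have h0 := hw.map_empty
  have hz0 := c.tightValue_empty hn h0
  have hzs := c.supermodular_tightValue hn hw.supermodular
  have hP := c.associahedron_eq_permPolytope hn h0
  refine ⟨c.tightValue w, c.minkowskiCoeff w, ?_, hP, fun a b _ => c.tightValue_R hn h0 a b, ?_,
    fun I hI => ⟨fun a b γ Γ hab hγ hΓ => ?_, c.minkowskiCoeff_eq_zero w hI⟩⟩
  · rw [hP]
    exact isTight_permPolytope hz0 hzs
  · intro y'
    rw [hP, isMinkowskiDecomposition_iff hz0 hzs, c.tightValue_eq_zetaSum hn h0]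
    constructor
    · intro h I hI
      exact (zetaSum_injective h I hI).symm
    · intro h
      funext I
      refine Finset.sum_congr rfl fun J hJ => ?_
      rw [h J (Finset.mem_filter.1 hJ).2]
  -- `z` and `w` agree on every `R`, edges and degenerate diagonals included, so all four terms may
  -- be read with `w`.
  · simp only [c.tightValue_R hn h0]
    exact c.minkowskiCoeff_of_isSpan hn w h0 hI (c.isSpan_of_downIntervals_eq hab) hγ hΓ
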